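/- Let $Y$ be a nonempty set with a $\sigma$-algebra such that $\{x : f(x)\neq g(x)\}$ is measurable for all measurable $f,g:\mathbb R\to Y$, and let $P$ be the uniform distribution on $(0,1)$. Let $H$ be a nonempty set of measurable functions $\mathbb R\to Y$ such that: (a) (zero-measure crossings) any two distinct $h,h'\in H$ satisfy $\lambda(\{x : h(x)=h'(x)\})=0$, where $\lambda$ is Lebesgue measure; (b) the graph dimension $d$ of $H$, i.e. the VC dimension of the collection of graphs $\{\{(x,h(x)) : x\in\mathbb R\} : h\in H\}$ of subsets of $\mathbb R\times Y$, satisfies $0<d<\infty$; (c) (measurability convention of VC theory) for every measurable $f:\mathbb R\to Y$, every $n$ and every $J\subseteq\{1,\dots,n\}$, the set of those $(x_1,\dots,x_n)\in(0,1)^n$ for which some $h\in H$ has $\{i : h(x_i)=f(x_i)\}=J$ is Lebesgue measurable. For $k\ge 1$ let $F_k(H)$ be the class of $k$-piecewise $H$ functions: all $g:\mathbb R\to Y$ for which there are $h_1,\dots,h_k\in H$ and reals $t_1\le\dots\le t_{k-1}$ such that, with $t_0=-\infty$ and $t_k=\infty$, $g(x)=h_i(x)$ whenever $t_{i-1}<x\le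 t_i$. An $s$-sample $q$-query $\varepsilon$-tester for $F_k(H)$ under $P$ is a randomized procedure that draws $s$ i.i.d. points from $P$, adaptively queries the value of an unknown measurable target $f:\mathbb R\to Y$ at no more than $q$ of these points, and then accepts or rejects, such that for every measurable $f$: acceptance is an event; if $f\in F_k(H)$, it accepts with probability at least $2/3$; and if $\inf_{g\in F_k(H)}P(x : f(x)\neq g(x))\ge\varepsilon$, it rejects with probability at least $2/3$. Theorem. There is a universal constant $C>0$ such that for all $Y$ and $H$ as above, every $k\ge 1$ and every $\varepsilon\in(0,1/2)$, there is an $s$-sample $q$-query $\varepsilon$-tester for $F_k(H)$ under $P$ with $$s\le C\,\frac{dk}{\varepsilon^{6}}\ln\frac1\varepsilon\qquad\text{and}\qquad q\le C\,\frac{d}{\varepsilon^{8}}\ln\frac1\varepsilon .$$ In particular, the bound on the number of queries does not depend on $k$. -/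

import Mathlib

open MeasureTheory

universe u v

/-- The collection `C` of subsets of `Z` shatters the finite set `S`: every subset of `S` is cut out
of `S` by a member of `C`. -/
def FamilyShatters {Z : Type v} (C : Set (Set Z)) (S : Finset Z) : Prop :=
  ∀ T : Set Z, T ⊆ (S : Set Z) → ∃ A ∈ C, A ∩ (S : Set Z) = T

/-- The VC dimension of a collection of sets: the supremum, in `ℕ∞`, of the sizes of the finite sets
which it shatters. -/
noncomputable def familyVCDim {Z : Type v} (C : Set (Set Z)) : ℕ∞ :=
  ⨆ (S : Finset Z) (_ : FamilyShatters C S), (S.card : ℕ∞)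

/-- The graph dimension of a class of functions `ℝ → Y`: the VC dimension, in `ℝ × Y`, of the
collection of their graphs. -/
noncomputable def graphDim {Y : Type u} (H : Set (ℝ → Y)) : ℕ∞ :=
  familyVCDim ((fun h : ℝ → Y => {z : ℝ × Y | z.2 = h z.1}) '' H)

/-- Zero-measure crossings: two distinct members of `H` agree only on a Lebesgue null set. -/
def ZeroMeasureCrossings {Y : Type u} (H : Set (ℝ → Y)) : Prop :=
  ∀ h ∈ H, ∀ h' ∈ H, h ≠ h' → volume {x : ℝ | h x = h' x} = 0

/-- The class of `k`-piecewise `H` functions, with breakpoints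
`-∞ = t₀ < t₁ ≤ ⋯ ≤ tₖ₋₁ < tₖ = ∞` where `t₁, …, tₖ₋₁` are real; the `i`-th piece is `(tᵢ₋₁, tᵢ]`. -/
def piecewiseClass {Y : Type u} (k : ℕ) (H : Set (ℝ → Y)) : Set (ℝ → Y) :=
  {g | ∃ (h : Fin k → ℝ → Y) (t : Fin (k + 1) → EReal),
    (∀ i, h i ∈ H) ∧ Monotone t ∧ t 0 = ⊥ ∧ t (Fin.last k) = ⊤ ∧
    (∀ i, i ≠ 0 → i ≠ Fin.last k → t i ≠ ⊥ ∧ t i ≠ ⊤) ∧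
    ∀ (i : Fin k) (x : ℝ), t i.castSucc < (x : EReal) → (x : EReal) ≤ t i.succ → g x = h i x}

/-- The distribution `Uniform(0,1)` on the line. -/
noncomputable def uniform01 : Measure ℝ := volume.restrict (Set.Ioo 0 1)

/-- The distance `inf_{g ∈ F} P(x : f x ≠ g x)` from `f` to the class `F`. -/
noncomputable def distToClass {Y : Type u} (P : Measure ℝ) (f : ℝ → Y) (F : Set (ℝ → Y)) :
    ENNReal :=
  ⨅ g ∈ F, P {x | f x ≠ g x}

/-- The σ-algebra of `Y` is fine enough for the disagreement set of two measurable functions to be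
measurable, so that their distance is defined. -/
def MeasurableDisagreement (Y : Type u) [MeasurableSpace Y] : Prop :=
  ∀ f g : ℝ → Y, Measurable f → Measurable g → MeasurableSet {x | f x ≠ g x}

/-- The usual measurability convention of VC theory, in a weak form: for every measurable target `f`,
it is an event (of the completed product distribution) for an `n`-point sample that some member of
`H` agrees with `f` at exactly a prescribed set `J` of the sample's indices. -/
def TraceMeasurable {Y : Type u} [MeasurableSpace Y] (P : Measure ℝ) (H : Set (ℝ → Y)) : Prop :=
  ∀ f : ℝ → Y, Measurable f → ∀ (n : ℕ) (J : Set (Fin n)),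
    NullMeasurableSet {x : Fin n → ℝ | ∃ h ∈ H, ∀ i, h (x i) = f (x i) ↔ i ∈ J}
      (Measure.pi fun _ : Fin n => P)

/-- An adaptive query strategy on a sample of `s` points which makes at most `q` queries: it either
halts with a decision (`true` is accept, `false` is reject), or queries the target's value at one of
the sample points and goes on depending on the answer. -/
inductive QueryTree (s : ℕ) (Y : Type u) : ℕ → Type u
  | halt {q : ℕ} (decision : Bool) : QueryTree s Y q
  | query {q : ℕ} (i : Fin s) (next : Y → QueryTree s Y q) : QueryTree s Y (q + 1)

/-- The decision reached when the target's value at the `i`-th sample point is `y i`. -/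
def QueryTree.run {s : ℕ} {Y : Type u} (y : Fin s → Y) : {q : ℕ} → QueryTree s Y q → Bool
  | _, .halt b => b
  | _, .query i next => (next (y i)).run y

/-- `A` is an `s`-sample `q`-query `ε`-tester for `F` under `P`. It sees the unlabeled sample `x` and
an independent random seed `ω` with law `ν`, which determine its query strategy; the target `f` is
accessible through the queries only. The probability is that of the sample and of the seed. -/
def IsActiveTester {Y : Type u} [MeasurableSpace Y] (P : Measure ℝ) (F : Set (ℝ → Y)) (ε : ℝ)
    {s q : ℕ} {Ω : Type} [MeasurableSpace Ω] (ν : Measure Ω)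
    (A : (Fin s → ℝ) → Ω → QueryTree s Y q) : Prop :=
  ∀ f : ℝ → Y, Measurable f →
    NullMeasurableSet {z : (Fin s → ℝ) × Ω | (A z.1 z.2).run (fun i => f (z.1 i)) = true}
      ((Measure.pi fun _ : Fin s => P).prod ν) ∧
    (f ∈ F → 2 / 3 ≤ ((Measure.pi fun _ : Fin s => P).prod ν)
      {z | (A z.1 z.2).run (fun i => f (z.1 i)) = true}) ∧
    (ENNReal.ofReal ε ≤ distToClass P f F → 2 / 3 ≤ ((Measure.pi fun _ : Fin s => P).prod ν)
      {z | (A z.1 z.2).run (fun i => f (z.1 i)) = false})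

/-- There is an `s`-sample `q`-query `ε`-tester for `F` under `P`. -/
def HasActiveTester {Y : Type u} [MeasurableSpace Y] (P : Measure ℝ) (F : Set (ℝ → Y)) (ε : ℝ)
    (s q : ℕ) : Prop :=
  ∃ (Ω : Type) (_ : MeasurableSpace Ω) (ν : Measure Ω) (_ : IsProbabilityMeasure ν)
    (A : (Fin s → ℝ) → Ω → QueryTree s Y q), IsActiveTester P F ε ν A

/-! Look at `f` through a window `(w, w + δ)` at a uniformly random position, where `δ = 1/(8kE)`
and `E = ⌈1/ε⌉`. If `f` is `k`-piecewise, a window without breakpoints is consistent with a member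
of `H`, so the inconsistent positions have measure at most `(k - 1)δ`. It suffices that a function
far from the class exceeds this by a margin `τ = 1/(64E²)` free of `k`: the proportion of bad
windows can then be estimated from a number of windows independent of `k`.

The margin (`le_volume_farSet_of_le_distToClass`): call a window far if every member of `H` differs
from `f` on it by measure at least `c = δ/(64E)`, and close otherwise. Two close windows which
overlap in length `2c` are close to the same member, since distinct members agree only on a null
set. Hence windows close to different members are separated by far positions of measure at least `δ
- 2c` (`le_volume_farSet_inter`), and the far mass to the left of a position, divided by `δ - 2c`
and rounded down, is a monotone index which determines the member
(`exists_monotone_index_of_farSet`). If the far set had measure below `(k - 1)δ + τ`, there would be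
at most `k + k/(4E)` pieces; merging the excess ones costs at most `1/(4E)`, and `f` would be closer
than `1/E ≤ ε` to the class.

Detection (`measure_pi_exists_consistent_le`): the sample is cut into blocks of `4kE` points, and a
block serves a window through the one point which is alone in it, if there is one. A window costs
one query per block, so only the sample size grows with `k`. The disagreement sets on blocks have
dimension at most `d`, and by the ε-net theorem `O(dE²)` blocks are likely to refute all members of
`H` on a far window. All windows share one sample; Markov's inequality copes with their dependence,
and Chebyshev's with the random positions. -/

/-! ### Nonadaptive strategies. -/

/-- The strategy which queries the sample points `idx 0, …, idx (q - 1)` and then decides. -/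
def QueryTree.nonadaptive {s : ℕ} {Y : Type u} :
    (q : ℕ) → (Fin q → Fin s) → ((Fin q → Y) → Bool) → QueryTree s Y q
  | 0, _, dec => .halt (dec Fin.elim0)
  | q + 1, idx, dec => .query (idx 0) fun y =>
      QueryTree.nonadaptive q (fun i => idx i.succ) fun v => dec (Fin.cons y v)

theorem QueryTree.run_nonadaptive {s : ℕ} {Y : Type u} (y : Fin s → Y) (q : ℕ)
    (idx : Fin q → Fin s) (dec : (Fin q → Y) → Bool) :
    (QueryTree.nonadaptive q idx dec).run y = dec fun i => y (idx i) := by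
  induction q with
  | zero =>
    simp only [QueryTree.nonadaptive, QueryTree.run]
    congr 1
    exact Subsingleton.elim _ _
  | succ q ih =>
    simp only [QueryTree.nonadaptive, QueryTree.run]
    rw [ih]
    congr 1
    funext i
    refine Fin.cases ?_ (fun j => ?_) i <;> simp

/-! ### Piecewise functions: monotone indices, merging of pieces, breakpoints. -/

instance isProbabilityMeasure_uniform01 : IsProbabilityMeasure uniform01 := by
  constructor
  simp [uniform01]

theorem uniform01_le_volume (s : Set ℝ) : uniform01 s ≤ volume s :=
  Measure.restrict_apply_le _ _

theorem uniform01_compl_Ioo : uniform01 (Set.Ioo 0 1)ᶜ = 0 := by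
  simp [uniform01, Measure.restrict_apply measurableSet_Ioo.compl]

theorem card_filter_eq_of_iff {n c : ℕ} {p : ℕ → Prop} [DecidablePred p] (hc : c ≤ n)
    (h : ∀ j < n, p j ↔ j < c) : ((Finset.range n).filter p).card = c := by
  have : (Finset.range n).filter p = Finset.range c := by
    ext j
    simp only [Finset.mem_filter, Finset.mem_range]
    constructor
    · rintro ⟨h1, h2⟩
      exact (h j h1).1 h2
    · intro h1
      exact ⟨by omega, (h j (by omega)).2 h1⟩
  rw [this, Finset.card_range]

/-- A function which is selected from members of `H` by a monotone index with `k` values is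
piecewise `H` on `(0,1)`, up to the breakpoints. -/
theorem distToClass_piecewiseClass_le {Y : Type u} {H : Set (ℝ → Y)} {k : ℕ} (hk : 1 ≤ k)
    (f : ℝ → Y) {φ : ℝ → ℕ} (hφ : Monotone φ) (hφk : ∀ x, φ x < k) {h : ℕ → ℝ → Y}
    (hH : ∀ j, h j ∈ H) :
    distToClass uniform01 f (piecewiseClass k H) ≤ uniform01 {x | f x ≠ h (φ x) x} := by
  classical
  -- The point `0` keeps the set nonempty, so that its supremum is a genuine real breakpoint even if
  -- no index in `(0,1)` is below `i`.
  set S : ℕ → Set ℝ := fun i => {0} ∪ {x | x ∈ Set.Ioo (0 : ℝ) 1 ∧ φ x < i} with hS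
  have hSne : ∀ i, (S i).Nonempty := fun i => ⟨0, Or.inl rfl⟩
  have hSbd : ∀ i, BddAbove (S i) := by
    intro i
    refine ⟨1, ?_⟩
    rintro x (rfl | hx)
    · exact zero_le_one
    · exact hx.1.2.le
  set a : ℕ → ℝ := fun i => sSup (S i) with ha
  have ha_mono : Monotone a := by
    intro i j hij
    refine csSup_le_csSup (hSbd j) (hSne i) ?_
    rintro x (hx | hx)
    · exact Or.inl hx
    · exact Or.inr ⟨hx.1, hx.2.trans_le hij⟩
  -- The strict inequality matches pieces which are closed on the right.
  set c : ℝ → ℕ := fun x => ((Finset.range (k - 1)).filter fun j => a (j + 1) < x).card with hc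
  set t : Fin (k + 1) → EReal := fun i =>
    if (i : ℕ) = 0 then ⊥ else if (i : ℕ) = k then ⊤ else ((a i : ℝ) : EReal) with ht
  have hmem : (fun x => h (c x) x) ∈ piecewiseClass k H := by
    refine ⟨fun i => h i, t, fun i => hH i, ?_, by simp [ht], ?_, ?_, ?_⟩
    · intro i j hij
      have hij' : (i : ℕ) ≤ j := hij
      have hj := j.isLt
      simp only [ht]
      by_cases hi0 : (i : ℕ) = 0
      · simp [hi0]
      by_cases hjk : (j : ℕ) = k
      · simp [hjk, show k ≠ 0 by omega]
      rw [if_neg hi0, if_neg (by omega), if_neg (by omega), if_neg hjk]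
      exact_mod_cast ha_mono hij'
    · simp [ht, show k ≠ 0 by omega]
    · intro i hi0 hik
      have h1 : (i : ℕ) ≠ 0 := fun h => hi0 (Fin.ext h)
      have h2 : (i : ℕ) ≠ k := fun h => hik (Fin.ext h)
      simp only [ht, if_neg h1, if_neg h2]
      exact ⟨EReal.coe_ne_bot _, EReal.coe_ne_top _⟩
    · intro i x h1 h2
      have hik := i.isLt
      have hcx : c x = i := by
        refine card_filter_eq_of_iff (by omega) fun j hj => ?_
        constructor
        · intro hjx
          by_contra hji
          push Not at hji
          simp only [ht, Fin.val_succ] at h2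
          rw [if_neg (by omega), if_neg (by omega)] at h2
          have h3 : x ≤ a (i + 1) := by exact_mod_cast h2
          have := ha_mono (show (i : ℕ) + 1 ≤ j + 1 by omega)
          linarith
        · intro hji
          simp only [ht, Fin.val_castSucc] at h1
          rw [if_neg (by omega), if_neg (by omega)] at h1
          have h3 : a i < x := by exact_mod_cast h1
          exact (ha_mono (show j + 1 ≤ (i : ℕ) by omega)).trans_lt h3
      simp only [hcx]
  have hle : distToClass uniform01 f (piecewiseClass k H) ≤
      uniform01 {x | f x ≠ h (c x) x} := iInf₂_le _ hmem
  refine hle.trans ?_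
  -- Inside `(0,1)` the indices `c` and `φ` can differ only at the finitely many breakpoints.
  set A : Set ℝ := a '' (Finset.range (k + 1) : Set ℕ) with hA
  have hAfin : A.Finite := (Finset.finite_toSet _).image _
  have hAnull : uniform01 A = 0 := le_antisymm ((uniform01_le_volume A).trans
    (hAfin.measure_zero volume).le) zero_le
  have hsub : {x | f x ≠ h (c x) x} ⊆ {x | f x ≠ h (φ x) x} ∪ ((Set.Ioo 0 1)ᶜ ∪ A) := by
    intro x hx
    by_cases hx01 : x ∈ Set.Ioo (0 : ℝ) 1
    swap
    · exact Or.inr (Or.inl hx01)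
    by_cases hxA : x ∈ A
    · exact Or.inr (Or.inr hxA)
    left
    have hcx : c x = φ x := by
      have := hφk x
      refine card_filter_eq_of_iff (by omega) fun j hj => ?_
      constructor
      · intro hjx
        by_contra hji
        push Not at hji
        have : x ≤ a (j + 1) := le_csSup (hSbd _) (Or.inr ⟨hx01, by omega⟩)
        linarith
      · intro hji
        refine lt_of_le_of_ne ?_ ?_
        · refine csSup_le (hSne _) ?_
          rintro y (rfl | hy)
          · exact hx01.1.le
          · by_contra hyx
            push Not at hyx
            have := hφ hyx.le
            have := hy.2
            omega
        · intro hax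
          exact hxA ⟨j + 1, by simp; omega, hax⟩
    simpa [hcx] using hx
  calc uniform01 {x | f x ≠ h (c x) x}
      ≤ uniform01 ({x | f x ≠ h (φ x) x} ∪ ((Set.Ioo 0 1)ᶜ ∪ A)) := measure_mono hsub
    _ ≤ uniform01 {x | f x ≠ h (φ x) x} + (uniform01 (Set.Ioo 0 1)ᶜ + uniform01 A) :=
        (measure_union_le _ _).trans (by gcongr; exact measure_union_le _ _)
    _ = uniform01 {x | f x ≠ h (φ x) x} := by rw [uniform01_compl_Ioo, hAnull]; simp

/-- Among `n + 1` pieces some piece has mass at most `1 / (n + 1)`, and it can be absorbed. -/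
theorem exists_merge_piece {Y : Type u} {H : Set (ℝ → Y)} {n : ℕ} (hn : 1 ≤ n)
    (f : ℝ → Y) {φ : ℝ → ℕ} (hφ : Monotone φ) (hφn : ∀ x, φ x < n + 1) {h : ℕ → ℝ → Y}
    (hH : ∀ j, h j ∈ H) :
    ∃ (φ' : ℝ → ℕ) (h' : ℕ → ℝ → Y), Monotone φ' ∧ (∀ x, φ' x < n) ∧ (∀ j, h' j ∈ H) ∧
      uniform01 {x | f x ≠ h' (φ' x) x} ≤
        uniform01 {x | f x ≠ h (φ x) x} + ((n + 1 : ℕ) : ENNReal)⁻¹ := by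
  obtain ⟨j, hj, hjmass⟩ : ∃ j ∈ Finset.range (n + 1),
      uniform01 (φ ⁻¹' {j}) ≤ ((n + 1 : ℕ) : ENNReal)⁻¹ := by
    have hdisj : (↑(Finset.range (n + 1)) : Set ℕ).PairwiseDisjoint fun j => φ ⁻¹' {j} := by
      intro i _ j _ hij
      refine Set.disjoint_left.2 fun x hx hx' => hij ?_
      exact (show φ x = i from hx).symm.trans hx'
    by_contra! hcon
    have hlt := ENNReal.sum_lt_sum_of_nonempty (by simp) hcon
    rw [← measure_biUnion_finset hdisj fun j _ => hφ.measurable (measurableSet_singleton j)] at hlt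
    simp only [Finset.sum_const, Finset.card_range, nsmul_eq_mul] at hlt
    rw [ENNReal.mul_inv_cancel (by simp) (by simp)] at hlt
    exact absurd prob_le_one hlt.not_ge
  have hjn : j < n + 1 := Finset.mem_range.1 hj
  -- The piece `j` is absorbed by its predecessor; for `j = 0`, truncated subtraction hands it to
  -- its successor instead.
  refine ⟨fun x => if φ x < j then φ x else φ x - 1, fun i => if i < j then h i else h (i + 1),
    ?_, ?_, ?_, ?_⟩
  · intro x y hxy
    have := hφ hxy
    dsimp only
    split_ifs <;> omega
  · intro x
    have := hφn x
    dsimp only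
    split_ifs <;> omega
  · intro i
    dsimp only
    split_ifs <;> exact hH _
  · have hsub : {x | f x ≠ (fun i => if i < j then h i else h (i + 1))
        (if φ x < j then φ x else φ x - 1) x} ⊆ {x | f x ≠ h (φ x) x} ∪ φ ⁻¹' {j} := by
      intro x hx
      by_cases hxj : φ x = j
      · exact Or.inr hxj
      left
      intro hfx
      apply hx
      dsimp only
      by_cases h1 : φ x < j
      · simpa [h1] using hfx
      · rw [if_neg h1, if_neg (by omega), show φ x - 1 + 1 = φ x by omega]
        exact hfx
    exact (measure_mono hsub).trans ((measure_union_le _ _).trans (by gcongr))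

/-- The `e` excess pieces are merged away one at a time. More than `k` pieces are present at each
merge, so each costs at most `1/k`. -/
theorem distToClass_piecewiseClass_le_add {Y : Type u} {H : Set (ℝ → Y)} {k : ℕ} (hk : 1 ≤ k)
    (f : ℝ → Y) (e : ℕ) : ∀ {φ : ℝ → ℕ}, Monotone φ → (∀ x, φ x < k + e) →
    ∀ {h : ℕ → ℝ → Y}, (∀ j, h j ∈ H) →
    distToClass uniform01 f (piecewiseClass k H) ≤
      uniform01 {x | f x ≠ h (φ x) x} + e * (k : ENNReal)⁻¹ := by
  induction e with
  | zero =>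
    intro φ hφ hφk h hH
    simpa using distToClass_piecewiseClass_le hk f hφ hφk hH
  | succ e ih =>
    intro φ hφ hφk h hH
    obtain ⟨φ', h', h1, h2, h3, h4⟩ := exists_merge_piece (n := k + e) (by omega) f hφ hφk hH
    refine (ih h1 h2 h3).trans ?_
    have h5 : (((k + e + 1 : ℕ) : ENNReal))⁻¹ ≤ (k : ENNReal)⁻¹ := by
      rw [ENNReal.inv_le_inv]
      exact_mod_cast (by omega : k ≤ k + e + 1)
    calc _ ≤ (uniform01 {x | f x ≠ h (φ x) x} + (k : ENNReal)⁻¹) + e * (k : ENNReal)⁻¹ := by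
          gcongr
          exact h4.trans (by gcongr)
      _ = _ := by push_cast; ring

/-- If no breakpoint of a piecewise function lies in a window, it agrees there with a member of
`H`; the breakpoints meet few windows. -/
theorem exists_breakpoints_of_mem_piecewiseClass {Y : Type u} {H : Set (ℝ → Y)} {k : ℕ}
    (hk : 1 ≤ k) {f : ℝ → Y} (hf : f ∈ piecewiseClass k H) (δ : ℝ) :
    ∃ A : Set ℝ, MeasurableSet A ∧ uniform01 A ≤ ENNReal.ofReal ((k - 1) * δ) ∧
      ∀ w ∉ A, ∃ h ∈ H, ∀ x ∈ Set.Ioo w (w + δ), h x = f x := by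
  obtain ⟨h, t, hH, htm, ht0, htk, htr, hfx⟩ := hf
  set τ : ℕ → ℝ := fun j => if hj : j < k + 1 then (t ⟨j, hj⟩).toReal else 0 with hτ
  -- The window `(w, w + δ)` contains `τ j` exactly when `w` lies in `(τ j - δ, τ j)`.
  refine ⟨⋃ j ∈ Finset.Icc 1 (k - 1), Set.Ioo (τ j - δ) (τ j),
    Finset.measurableSet_biUnion _ fun _ _ => measurableSet_Ioo, ?_, ?_⟩
  · refine (measure_biUnion_finset_le _ _).trans ?_
    calc ∑ j ∈ Finset.Icc 1 (k - 1), uniform01 (Set.Ioo (τ j - δ) (τ j))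
        ≤ ∑ j ∈ Finset.Icc 1 (k - 1), ENNReal.ofReal δ := by
          refine Finset.sum_le_sum fun j _ => (uniform01_le_volume _).trans ?_
          simp
      _ = ENNReal.ofReal ((k - 1) * δ) := by
          have h1 : (1 : ℝ) ≤ k := by exact_mod_cast hk
          rw [Finset.sum_const, Nat.card_Icc, nsmul_eq_mul, ENNReal.ofReal_mul (by linarith),
            show k - 1 + 1 - 1 = k - 1 by omega, ← ENNReal.ofReal_natCast, Nat.cast_sub hk,
            Nat.cast_one]
  · intro w hw
    simp only [Finset.mem_Icc, Set.mem_iUnion, Set.mem_Ioo, not_exists, not_and, not_lt] at hw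
    -- The piece which holds the midpoint of the window must cover all of it.
    have hex : ∃ i : Fin k, t i.castSucc < ((w + δ / 2 : ℝ) : EReal) ∧
        ((w + δ / 2 : ℝ) : EReal) ≤ t i.succ := by
      by_contra hcon
      push Not at hcon
      have hall : ∀ j : ℕ, ∀ hj : j < k + 1, t ⟨j, hj⟩ < ((w + δ / 2 : ℝ) : EReal) := by
        intro j
        induction j with
        | zero =>
          intro hj
          have : t ⟨0, hj⟩ = ⊥ := ht0
          rw [this]
          exact EReal.bot_lt_coe _
        | succ j ih =>
          intro hj
          exact hcon ⟨j, by omega⟩ (ih (by omega))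
      have h1 := hall k (by omega)
      have h2 : t ⟨k, by omega⟩ = ⊤ := htk
      rw [h2] at h1
      exact not_top_lt h1
    obtain ⟨i, hi1, hi2⟩ := hex
    have key : ∀ j : ℕ, ∀ hj : j < k + 1, 1 ≤ j → j ≤ k - 1 → t ⟨j, hj⟩ = ((τ j : ℝ) : EReal) := by
      intro j hj h1 h2
      have h3 := htr ⟨j, hj⟩ (by intro h; have := congrArg Fin.val h; simp at this; omega)
        (by intro h; have := congrArg Fin.val h; simp at this; omega)
      simp only [hτ, dif_pos hj]
      exact (EReal.coe_toReal h3.2 h3.1).symm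
    refine ⟨h i, hH i, fun x hx => (hfx i x ?_ ?_).symm⟩
    · by_cases hi0 : (i : ℕ) = 0
      · have : t i.castSucc = ⊥ := by
          rw [← ht0]
          congr 1
          exact Fin.ext hi0
        rw [this]
        exact EReal.bot_lt_coe _
      · have h1 := key i (by omega) (by omega) (by omega)
        have h2 : t i.castSucc = ((τ i : ℝ) : EReal) := h1
        rw [h2] at hi1 ⊢
        have h3 : τ i < w + δ / 2 := by exact_mod_cast hi1
        have h4 := hw i ⟨by omega, by omega⟩
        have h5 : τ i ≤ w := by
          by_contra h6
          push Not at h6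
          have := h4 (by linarith)
          linarith
        exact_mod_cast h5.trans_lt hx.1
    · by_cases hik : (i : ℕ) + 1 = k
      · have : t i.succ = ⊤ := by
          rw [← htk]
          congr 1
          exact Fin.ext (by simpa using hik)
        rw [this]
        exact le_top
      · have h1 := key (i + 1) (by omega) (by omega) (by omega)
        have h2 : t i.succ = ((τ (i + 1) : ℝ) : EReal) := h1
        rw [h2] at hi2 ⊢
        have h3 : w + δ / 2 ≤ τ (i + 1) := by exact_mod_cast hi2
        have h4 := hw (i + 1) ⟨by omega, by omega⟩
        have h5 : w + δ ≤ τ (i + 1) := by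
          by_contra h6
          push Not at h6
          have := h4 (by linarith)
          linarith
        exact_mod_cast hx.2.le.trans h5

/-! ### Close and far windows. -/

/-- `h` is a member of `H` from which `f` differs by measure less than `c` on the window
`(w, w + δ)`. -/
def WindowClose {Y : Type u} (H : Set (ℝ → Y)) (f : ℝ → Y) (δ c : ℝ) (h : ℝ → Y) (w : ℝ) : Prop :=
  h ∈ H ∧ volume ({x | f x ≠ h x} ∩ Set.Ioo w (w + δ)) < ENNReal.ofReal c

/-- The positions in `(0, 1 - δ)` of the windows on which `f` differs from every member of `H` by
measure at least `c`. -/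
def farSet {Y : Type u} (H : Set (ℝ → Y)) (f : ℝ → Y) (δ c : ℝ) : Set ℝ :=
  {w | w ∈ Set.Ioo 0 (1 - δ) ∧ ∀ h, ¬ WindowClose H f δ c h w}

/-- Moving the window by some distance adds at most that distance to the disagreement. Openness
survives the uncountable union over `H`, which makes the far set measurable. -/
theorem isOpen_setOf_windowClose {Y : Type u} (H : Set (ℝ → Y)) (f : ℝ → Y) (δ c : ℝ)
    (h : ℝ → Y) : IsOpen {w | WindowClose H f δ c h w} := by
  rw [isOpen_iff_mem_nhds]
  intro w hw
  have hle : ∀ w' : ℝ, volume ({x | f x ≠ h x} ∩ Set.Ioo w' (w' + δ)) ≤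
      volume ({x | f x ≠ h x} ∩ Set.Ioo w (w + δ)) +
        (ENNReal.ofReal (w - w') + ENNReal.ofReal (w' - w)) := by
    intro w'
    have hsub : {x | f x ≠ h x} ∩ Set.Ioo w' (w' + δ) ⊆
        ({x | f x ≠ h x} ∩ Set.Ioo w (w + δ)) ∪ (Set.Ioc w' w ∪ Set.Ico (w + δ) (w' + δ)) := by
      rintro x ⟨hx, hx1, hx2⟩
      by_cases h1 : x ≤ w
      · exact Or.inr (Or.inl ⟨hx1, h1⟩)
      by_cases h2 : w + δ ≤ x
      · exact Or.inr (Or.inr ⟨h2, hx2⟩)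
      exact Or.inl ⟨hx, not_le.1 h1, not_le.1 h2⟩
    refine (measure_mono hsub).trans ((measure_union_le _ _).trans ?_)
    gcongr
    refine (measure_union_le _ _).trans (le_of_eq ?_)
    rw [Real.volume_Ioc, Real.volume_Ico]
    congr 2
    ring
  have htend : Filter.Tendsto (fun w' : ℝ => volume ({x | f x ≠ h x} ∩ Set.Ioo w (w + δ)) +
        (ENNReal.ofReal (w - w') + ENNReal.ofReal (w' - w))) (nhds w)
      (nhds (volume ({x | f x ≠ h x} ∩ Set.Ioo w (w + δ)) +
        (ENNReal.ofReal (w - w) + ENNReal.ofReal (w - w)))) := by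
    refine Filter.Tendsto.add tendsto_const_nhds (Filter.Tendsto.add ?_ ?_)
    · exact ENNReal.tendsto_ofReal (tendsto_const_nhds.sub Filter.tendsto_id)
    · exact ENNReal.tendsto_ofReal (Filter.tendsto_id.sub tendsto_const_nhds)
  have hlt : volume ({x | f x ≠ h x} ∩ Set.Ioo w (w + δ)) +
        (ENNReal.ofReal (w - w) + ENNReal.ofReal (w - w)) < ENNReal.ofReal c := by
    simpa using hw.2
  filter_upwards [htend.eventually_lt_const hlt] with w' hw'
  exact ⟨hw.1, (hle w').trans_lt hw'⟩

theorem measurableSet_farSet {Y : Type u} (H : Set (ℝ → Y)) (f : ℝ → Y) (δ c : ℝ) :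
    MeasurableSet (farSet H f δ c) := by
  have : farSet H f δ c = Set.Ioo 0 (1 - δ) \ ⋃ h, {w | WindowClose H f δ c h w} := by
    ext w
    simp [farSet]
  rw [this]
  exact measurableSet_Ioo.diff (isOpen_iUnion fun h => isOpen_setOf_windowClose H f δ c h).measurableSet

/-- The windows overlap in length at least `2 * c`, and `f` leaves `h` or `h'` on less than that, so
`h` and `h'` agree on a set of positive measure. -/
theorem WindowClose.eq {Y : Type u} {H : Set (ℝ → Y)} (hZ : ZeroMeasureCrossings H) {f : ℝ → Y}
    {δ c : ℝ} {h h' : ℝ → Y} {w w' : ℝ} (h1 : WindowClose H f δ c h w)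
    (h2 : WindowClose H f δ c h' w') (hw : w ≤ w') (hw' : w' - w ≤ δ - 2 * c) : h = h' := by
  by_contra hne
  have hz := hZ h h1.1 h' h2.1 hne
  have hc : 0 < c := by
    have := (zero_le (a := volume ({x | f x ≠ h x} ∩ Set.Ioo w (w + δ)))).trans_lt h1.2
    simpa using this
  have hsub : Set.Ioo w' (w + δ) ⊆ (({x | f x ≠ h x} ∩ Set.Ioo w (w + δ)) ∪
      ({x | f x ≠ h' x} ∩ Set.Ioo w' (w' + δ))) ∪ {x | h x = h' x} := by
    rintro x ⟨hx1, hx2⟩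
    by_cases e1 : f x = h x
    · by_cases e2 : f x = h' x
      · exact Or.inr (e1.symm.trans e2)
      · exact Or.inl (Or.inr ⟨e2, hx1, by linarith⟩)
    · exact Or.inl (Or.inl ⟨e1, by linarith, hx2⟩)
  have h3 := (measure_mono (μ := volume) hsub).trans ((measure_union_le _ _).trans
    (add_le_add_left (measure_union_le _ _) _))
  rw [hz, add_zero, Real.volume_Ioo] at h3
  have h4 := h3.trans_lt (ENNReal.add_lt_add h1.2 h2.2)
  rw [← ENNReal.ofReal_add hc.le hc.le, ENNReal.ofReal_lt_ofReal_iff (by linarith)] at h4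
  linarith

/-- Between two windows which are close to different members of `H`, there is a gap of far
windows. -/
theorem le_volume_farSet_inter {Y : Type u} {H : Set (ℝ → Y)} (hZ : ZeroMeasureCrossings H)
    {f : ℝ → Y} {δ c : ℝ} {h h' : ℝ → Y} {w w' : ℝ} (h1 : WindowClose H f δ c h w)
    (h2 : WindowClose H f δ c h' w') (hne : h ≠ h') (hw : 0 < w) (hww : w ≤ w') (hw' : w' < 1 - δ) :
    ENNReal.ofReal (δ - 2 * c) ≤ volume (farSet H f δ c ∩ Set.Ioo w w') := by
  -- Here `b` is the infimum of the positions close to a member other than `h`, and `a` the supremum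
  -- of those up to `b` close to `h`. Every position strictly between is far.
  set A : Set ℝ := {v | v ∈ Set.Icc w w' ∧ ∃ g, WindowClose H f δ c g v ∧ g ≠ h} with hA
  have hAne : A.Nonempty := ⟨w', ⟨hww, le_rfl⟩, h', h2, hne.symm⟩
  have hAbd : BddBelow A := ⟨w, fun v hv => hv.1.1⟩
  set b := sInf A with hb
  have hwb : w ≤ b := le_csInf hAne fun v hv => hv.1.1
  have hbw : b ≤ w' := csInf_le hAbd ⟨⟨hww, le_rfl⟩, h', h2, hne.symm⟩
  set A' : Set ℝ := {v | v ∈ Set.Icc w b ∧ WindowClose H f δ c h v} with hA'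
  have hA'w : w ∈ A' := ⟨⟨le_rfl, hwb⟩, h1⟩
  have hA'bd : BddAbove A' := ⟨b, fun v hv => hv.1.2⟩
  set a := sSup A' with ha
  have hwa : w ≤ a := le_csSup hA'bd hA'w
  have hsub : Set.Ioo a b ⊆ farSet H f δ c ∩ Set.Ioo w w' := by
    rintro v ⟨hv1, hv2⟩
    refine ⟨⟨⟨by linarith, by linarith⟩, fun g hg => ?_⟩, by linarith, by linarith⟩
    by_cases hgh : g = h
    · rw [hgh] at hg
      have : v ≤ a := le_csSup hA'bd ⟨⟨by linarith, hv2.le⟩, hg⟩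
      linarith
    · have : b ≤ v := csInf_le hAbd ⟨⟨by linarith, by linarith⟩, g, hg, hgh⟩
      linarith
  refine le_trans ?_ (measure_mono hsub)
  rw [Real.volume_Ioo]
  refine ENNReal.ofReal_le_ofReal ?_
  -- If the gap falls short of `δ - 2 * c`, half of the shortfall is spent on approaching each of
  -- `a` and `b`, which yields two windows too near to be close to different members.
  by_contra! hcon
  obtain ⟨v, hv, hva⟩ := exists_lt_of_lt_csSup ⟨w, hA'w⟩
    (show a - (δ - 2 * c - (b - a)) / 2 < sSup A' by linarith)
  obtain ⟨v', hv', hvb⟩ := exists_lt_of_csInf_lt hAne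
    (show sInf A < b + (δ - 2 * c - (b - a)) / 2 by linarith)
  obtain ⟨g, hg, hgh⟩ := hv'.2
  have hbv' : b ≤ v' := csInf_le hAbd hv'
  exact hgh (WindowClose.eq hZ hv.2 hg (hv.1.2.trans hbv') (by linarith)).symm

/-- The sum telescopes to two terms at each end. It will count the jumps of an index across two
adjacent grid cells. -/
theorem sum_range_shift_two_sub_le {a : ℕ → ℝ} {M : ℝ} (h0 : ∀ i, 0 ≤ a i) (hM : ∀ i, a i ≤ M)
    (n : ℕ) : ∑ i ∈ Finset.range n, (a (i + 2) - a i) ≤ 2 * M := by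
  have h : ∀ n, ∑ i ∈ Finset.range n, (a (i + 2) - a i) = a (n + 1) + a n - a 1 - a 0 := by
    intro n
    induction n with
    | zero => simp
    | succ n ih => rw [Finset.sum_range_succ, ih]; ring
  rw [h]
  have := h0 0; have := h0 1; have := hM n; have := hM (n + 1)
  linarith

/-- If few windows are far from `H`, then `f` is close to a function which is selected from members
of `H` by a monotone index with few values. -/
theorem exists_monotone_index_of_farSet {Y : Type u} {H : Set (ℝ → Y)} (hne : H.Nonempty)
    (hZ : ZeroMeasureCrossings H) (f : ℝ → Y) {m : ℕ} (hm : 2 ≤ m) {δ c : ℝ} (hδ : δ = 2 / m)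
    (hc : 0 < c) (hcδ : 2 * c < δ) :
    ∃ (φ : ℝ → ℕ) (h : ℕ → ℝ → Y), Monotone φ ∧
      (∀ x, φ x ≤ ⌊volume.real (farSet H f δ c) / (δ - 2 * c)⌋₊) ∧ (∀ j, h j ∈ H) ∧
      uniform01.real {x | f x ≠ h (φ x) x} ≤ δ + m * c +
        δ * ⌊volume.real (farSet H f δ c) / (δ - 2 * c)⌋₊ + volume.real (farSet H f δ c) := by
  classical
  obtain ⟨h₀, hh₀⟩ := hne
  have hm0 : (0 : ℝ) < m := by exact_mod_cast (by omega : 0 < m)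
  set B := farSet H f δ c with hB
  set r := δ - 2 * c with hr
  have hr0 : 0 < r := by linarith
  have hBfin : volume B ≠ ⊤ := by
    refine ((measure_mono (t := Set.Ioo 0 (1 - δ)) fun x hx => hx.1).trans_lt ?_).ne
    simp
  have hfin : ∀ s, volume (B ∩ s) ≠ ⊤ := fun s =>
    ((measure_mono Set.inter_subset_left).trans_lt hBfin.lt_top).ne
  -- The index advances each time another `r` of far mass has been passed, which is the least mass
  -- separating windows close to different members.
  set β : ℝ → ℝ := fun x => volume.real (B ∩ Set.Iio x) with hβ
  have hβmono : Monotone β := fun x y hxy =>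
    measureReal_mono (Set.inter_subset_inter_right _ (Set.Iio_subset_Iio hxy)) (hfin _)
  set φ : ℝ → ℕ := fun x => ⌊β x / r⌋₊ with hφ
  have hφmono : Monotone φ := fun x y hxy =>
    Nat.floor_mono (div_le_div_of_nonneg_right (hβmono hxy) hr0.le)
  set K := ⌊volume.real B / r⌋₊ with hK
  have hφK : ∀ x, φ x ≤ K := fun x => Nat.floor_mono (div_le_div_of_nonneg_right
    (measureReal_mono Set.inter_subset_left hBfin) hr0.le)
  have hclose_eq : ∀ {g g' : ℝ → Y} {w w' : ℝ}, WindowClose H f δ c g w →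
      WindowClose H f δ c g' w' → 0 < w → w ≤ w' → w' < 1 - δ → φ w = φ w' → g = g' := by
    intro g g' w w' h1 h2 hw hww hw' hφw
    by_contra hgg
    have h3 := le_volume_farSet_inter hZ h1 h2 hgg hw hww hw'
    have h4 : r ≤ volume.real (B ∩ Set.Ioo w w') :=
      (ENNReal.ofReal_le_iff_le_toReal (hfin _)).1 h3
    have h5 : β w + volume.real (B ∩ Set.Ioo w w') ≤ β w' := by
      rw [hβ]
      dsimp only
      rw [← measureReal_union ?_ ((measurableSet_farSet H f δ c).inter measurableSet_Ioo)
        (hfin _) (hfin _)]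
      · refine measureReal_mono ?_ (hfin _)
        rintro x (hx | hx)
        · exact ⟨hx.1, lt_of_lt_of_le hx.2 hww⟩
        · exact ⟨hx.1, hx.2.2⟩
      · refine Set.disjoint_left.2 fun x hx hx' => ?_
        exact absurd hx.2 (not_lt.2 hx'.2.1.le)
    have h6 : φ w + 1 ≤ φ w' := by
      simp only [hφ]
      rw [← Nat.floor_add_one (div_nonneg measureReal_nonneg hr0.le)]
      refine Nat.floor_mono ?_
      rw [div_add_one hr0.ne']
      gcongr
      linarith
    omega
  set P : ℕ → (ℝ → Y) → Prop := fun j g =>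
    ∃ w ∈ Set.Ioo 0 (1 - δ), WindowClose H f δ c g w ∧ φ w = j with hP
  set h : ℕ → ℝ → Y := fun j => if hj : ∃ g, P j g then hj.choose else h₀ with hh
  have hh_eq : ∀ {w : ℝ} {g : ℝ → Y}, w ∈ Set.Ioo 0 (1 - δ) → WindowClose H f δ c g w →
      h (φ w) = g := by
    intro w g hw hg
    have hj : ∃ g, P (φ w) g := ⟨g, w, hw, hg, rfl⟩
    simp only [hh, dif_pos hj]
    obtain ⟨w', hw', hg', hφw'⟩ := hj.choose_spec
    rcases le_total w w' with hle | hle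
    · exact (hclose_eq hg hg' hw.1 hle hw'.2 hφw'.symm).symm
    · exact hclose_eq hg' hg hw'.1 hle hw.2 hφw'
  have hhH : ∀ j, h j ∈ H := by
    intro j
    simp only [hh]
    split_ifs with hj
    · obtain ⟨w', hw', hg', hφw'⟩ := hj.choose_spec
      exact hg'.1
    · exact hh₀
  refine ⟨φ, h, hφmono, hφK, hhH, ?_⟩
  set D : Set ℝ := {x | f x ≠ h (φ x) x} with hD
  have hDfin : ∀ a b : ℝ, volume (D ∩ Set.Ico a b) ≠ ⊤ := fun a b =>
    ((measure_mono Set.inter_subset_right).trans_lt (by simp : volume (Set.Ico a b) < ⊤)).ne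
  -- As `δ = 2 / m`, a window starting in one grid cell covers the next. If the index jumps across
  -- the two cells, the second is charged in full. If not, and some window starting in the first is
  -- close, the disagreement is at most `c`. Otherwise the first cell is entirely far and pays for
  -- the second.
  have hcell : ∀ i ∈ Finset.range (m - 2),
      volume.real (D ∩ Set.Ico (((i : ℝ) + 1) / m) (((i : ℝ) + 2) / m)) ≤
      c + 1 / m * ((φ (((i + 2 : ℕ) : ℝ) / m) : ℝ) - φ ((i : ℝ) / m)) +
        volume.real (B ∩ Set.Ioo ((i : ℝ) / m) (((i : ℝ) + 1) / m)) := by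
    intro i hi
    have him : (i : ℝ) + 3 ≤ m := by
      have : i + 3 ≤ m := by have := Finset.mem_range.1 hi; omega
      exact_mod_cast this
    have hlen : volume.real (D ∩ Set.Ico (((i : ℝ) + 1) / m) (((i : ℝ) + 2) / m)) ≤ 1 / m := by
      refine (measureReal_mono Set.inter_subset_right (by simp)).trans ?_
      rw [Real.volume_real_Ico_of_le (by gcongr; linarith)]
      apply le_of_eq
      ring
    have hi0 : (i : ℝ) / m ≤ ((i + 2 : ℕ) : ℝ) / m := by gcongr; omega
    have hmono := hφmono hi0
    rcases hmono.lt_or_eq with hlt | heq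
    · have h1 : (1 : ℝ) ≤ (φ (((i + 2 : ℕ) : ℝ) / m) : ℝ) - φ ((i : ℝ) / m) := by
        have : (φ ((i : ℝ) / m) : ℝ) + 1 ≤ φ (((i + 2 : ℕ) : ℝ) / m) := by exact_mod_cast hlt
        linarith
      have h2 : 1 / (m : ℝ) ≤ 1 / m * ((φ (((i + 2 : ℕ) : ℝ) / m) : ℝ) - φ ((i : ℝ) / m)) :=
        le_mul_of_one_le_right (by positivity) h1
      have h3 : 0 ≤ volume.real (B ∩ Set.Ioo ((i : ℝ) / m) (((i : ℝ) + 1) / m)) :=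
        measureReal_nonneg
      linarith
    · rw [heq, sub_self, mul_zero, add_zero]
      by_cases hex : ∃ w ∈ Set.Ioo ((i : ℝ) / m) (((i : ℝ) + 1) / m), ∃ g, WindowClose H f δ c g w
      · obtain ⟨w, hw, g, hg⟩ := hex
        have hw0 : 0 < w := lt_of_le_of_lt (by positivity) hw.1
        have hw1 : w < 1 - δ := by
          refine hw.2.trans_le ?_
          rw [hδ, div_le_iff₀ hm0, sub_mul, div_mul_cancel₀ _ hm0.ne']
          linarith
        have h1 : D ∩ Set.Ico (((i : ℝ) + 1) / m) (((i : ℝ) + 2) / m) ⊆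
            {x | f x ≠ g x} ∩ Set.Ioo w (w + δ) := by
          rintro x ⟨hx, hx1, hx2⟩
          refine ⟨?_, hw.2.trans_le hx1, ?_⟩
          · have e1 : φ w = φ x := by
              have a1 := hφmono hw.1.le
              have a2 := hφmono (hw.2.le.trans hx1)
              have a3 : φ x ≤ φ (((i + 2 : ℕ) : ℝ) / m) := hφmono (by push_cast; exact hx2.le)
              omega
            have e2 := hh_eq ⟨hw0, hw1⟩ hg
            intro hfx
            apply hx
            rw [← e1, e2]
            exact hfx
          · have : ((i : ℝ) + 2) / m = i / m + δ := by rw [hδ]; ring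
            rw [this] at hx2
            linarith [hw.1]
        have h2 : volume.real (D ∩ Set.Ico (((i : ℝ) + 1) / m) (((i : ℝ) + 2) / m)) ≤ c := by
          refine ENNReal.toReal_le_of_le_ofReal hc.le ?_
          exact (measure_mono h1).trans hg.2.le
        have h3 : 0 ≤ volume.real (B ∩ Set.Ioo ((i : ℝ) / m) (((i : ℝ) + 1) / m)) :=
          measureReal_nonneg
        linarith
      · push Not at hex
        have h1 : B ∩ Set.Ioo ((i : ℝ) / m) (((i : ℝ) + 1) / m) =
            Set.Ioo ((i : ℝ) / m) (((i : ℝ) + 1) / m) := by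
          refine Set.inter_eq_right.2 fun w hw => ⟨⟨?_, ?_⟩, hex w hw⟩
          · exact lt_of_le_of_lt (by positivity) hw.1
          · refine hw.2.trans_le ?_
            rw [hδ, div_le_iff₀ hm0, sub_mul, div_mul_cancel₀ _ hm0.ne']
            linarith
        rw [h1, Real.volume_real_Ioo_of_le (by gcongr; linarith)]
        have h2 : ((i : ℝ) + 1) / m - i / m = 1 / m := by ring
        rw [h2]
        linarith
  -- The first and the last cell are charged in full, since the cells before them lie outside the
  -- admissible positions `(0, 1 - δ)`.
  have hcover : D ∩ Set.Ioo 0 1 ⊆ (Set.Ioo 0 (1 / (m : ℝ)) ∪ Set.Ico (1 - 1 / (m : ℝ)) 1) ∪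
      ⋃ i ∈ Finset.range (m - 2), D ∩ Set.Ico (((i : ℝ) + 1) / m) (((i : ℝ) + 2) / m) := by
    rintro x ⟨hx, hx0, hx1⟩
    by_cases e1 : x < 1 / m
    · exact Or.inl (Or.inl ⟨hx0, e1⟩)
    by_cases e2 : 1 - 1 / (m : ℝ) ≤ x
    · exact Or.inl (Or.inr ⟨e2, hx1⟩)
    push Not at e1 e2
    right
    have a1 : 1 ≤ x * m := by rwa [div_le_iff₀ hm0] at e1
    have a2 : x * m < m - 1 := by
      have := mul_lt_mul_of_pos_right e2 hm0
      rwa [sub_mul, one_mul, div_mul_cancel₀ _ hm0.ne'] at this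
    have b1 : 1 ≤ ⌊x * m⌋₊ := Nat.le_floor (by simpa using a1)
    have b2 : ⌊x * m⌋₊ < m - 1 := by
      rw [Nat.floor_lt (by linarith), Nat.cast_sub (by omega)]
      simpa using a2
    have c1 := Nat.floor_le (show 0 ≤ x * m by linarith)
    have c2 := Nat.lt_floor_add_one (x * m)
    have d1 : (((⌊x * m⌋₊ - 1 : ℕ) : ℝ)) = ⌊x * m⌋₊ - 1 := by
      rw [Nat.cast_sub b1]; simp
    simp only [Set.mem_iUnion]
    refine ⟨⌊x * m⌋₊ - 1, Finset.mem_range.2 (by omega), hx, ?_, ?_⟩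
    · rw [div_le_iff₀ hm0, d1]; linarith
    · rw [lt_div_iff₀ hm0, d1]; linarith
  have hsumB : ∑ i ∈ Finset.range (m - 2),
      volume.real (B ∩ Set.Ioo ((i : ℝ) / m) (((i : ℝ) + 1) / m)) ≤ volume.real B := by
    rw [← measureReal_biUnion_finset]
    · refine measureReal_mono ?_ hBfin
      simp
    · intro i _ j _ hij
      refine Set.disjoint_left.2 fun x hx hx' => hij ?_
      have a1 := hx.2.1; have a2 := hx.2.2; have a3 := hx'.2.1; have a4 := hx'.2.2
      rw [div_lt_iff₀ hm0] at a1 a3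
      rw [lt_div_iff₀ hm0] at a2 a4
      have e1 : (i : ℝ) < j + 1 := a1.trans a4
      have e2 : (j : ℝ) < i + 1 := a3.trans a2
      have e3 : i < j + 1 := by exact_mod_cast e1
      have e4 : j < i + 1 := by exact_mod_cast e2
      omega
    · exact fun i _ => (measurableSet_farSet H f δ c).inter measurableSet_Ioo
  have hm2 : (2 : ℝ) ≤ m := by exact_mod_cast hm
  have h1m : 1 / (m : ℝ) ≤ 1 := by rw [div_le_one hm0]; linarith
  have hends : volume.real (Set.Ioo 0 (1 / (m : ℝ)) ∪ Set.Ico (1 - 1 / (m : ℝ)) 1) ≤ δ := by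
    refine (measureReal_union_le _ _).trans ?_
    have : (0 : ℝ) ≤ 1 / m := by positivity
    rw [Real.volume_real_Ioo_of_le this, Real.volume_real_Ico_of_le (by linarith), hδ]
    apply le_of_eq
    ring
  have huD : uniform01.real D = volume.real (D ∩ Set.Ioo 0 1) := by
    simp only [uniform01, Measure.real]
    rw [Measure.restrict_apply' measurableSet_Ioo]
  have hunionfin : volume (⋃ i ∈ Finset.range (m - 2),
      D ∩ Set.Ico (((i : ℝ) + 1) / m) (((i : ℝ) + 2) / m)) ≠ ⊤ := by
    refine ((measure_biUnion_finset_le _ _).trans_lt ?_).ne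
    exact ENNReal.sum_lt_top.2 fun i _ => (hDfin _ _).lt_top
  have hsumφ : ∑ i ∈ Finset.range (m - 2),
      ((φ (((i + 2 : ℕ) : ℝ) / m) : ℝ) - φ ((i : ℝ) / m)) ≤ 2 * K :=
    sum_range_shift_two_sub_le (a := fun i : ℕ => (φ ((i : ℝ) / m) : ℝ))
      (fun i => by positivity) (fun i => by exact_mod_cast hφK _) _
  rw [huD]
  calc volume.real (D ∩ Set.Ioo 0 1)
      ≤ δ + ∑ i ∈ Finset.range (m - 2),
          volume.real (D ∩ Set.Ico (((i : ℝ) + 1) / m) (((i : ℝ) + 2) / m)) := by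
        refine (measureReal_mono hcover ?_).trans ((measureReal_union_le _ _).trans ?_)
        · refine measure_union_ne_top ?_ hunionfin
          exact measure_union_ne_top (by simp) (by simp)
        · exact add_le_add hends (measureReal_biUnion_finset_le _ _)
    _ ≤ δ + ∑ i ∈ Finset.range (m - 2),
          (c + 1 / m * ((φ (((i + 2 : ℕ) : ℝ) / m) : ℝ) - φ ((i : ℝ) / m)) +
          volume.real (B ∩ Set.Ioo ((i : ℝ) / m) (((i : ℝ) + 1) / m))) := by
        gcongr with i hi
        exact hcell i hi
    _ ≤ δ + m * c + δ * K + volume.real B := by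
        rw [Finset.sum_add_distrib, Finset.sum_add_distrib, ← Finset.mul_sum, Finset.sum_const,
          Finset.card_range, nsmul_eq_mul]
        have e1 : ((m - 2 : ℕ) : ℝ) * c ≤ m * c := by
          gcongr
          omega
        have e2 : 1 / (m : ℝ) * ∑ i ∈ Finset.range (m - 2),
            ((φ (((i + 2 : ℕ) : ℝ) / m) : ℝ) - φ ((i : ℝ) / m)) ≤ δ * K := by
          calc _ ≤ 1 / (m : ℝ) * (2 * K) := by gcongr
            _ = δ * K := by rw [hδ]; ring
        linarith

/-! ### Chebyshev's inequality, symmetrization and ε-nets. -/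

open Classical in
/-- Chebyshev's inequality for the number of points of an i.i.d. sample which fall into `A`. -/
theorem measure_pi_le_abs_card_sub {Z ι : Type*} [MeasurableSpace Z] [Fintype ι] (μ : Measure Z)
    [IsProbabilityMeasure μ] {A : Set Z} (hA : MeasurableSet A) {a : ℝ} (ha : 0 < a) :
    (Measure.pi fun _ : ι => μ) {z | a ≤ |((Finset.univ.filter fun i => z i ∈ A).card : ℝ) -
      Fintype.card ι * μ.real A|} ≤ ENNReal.ofReal (Fintype.card ι * μ.real A / a ^ 2) := by
  set X : Z → ℝ := A.indicator 1 with hX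
  have hXm : Measurable X := measurable_const.indicator hA
  have hX01 : ∀ z, X z ∈ Set.Icc (0 : ℝ) 1 := by
    intro z
    by_cases hz : z ∈ A <;> simp [hX, hz]
  have hXL : MemLp X 2 μ :=
    memLp_of_bounded (Filter.Eventually.of_forall hX01) hXm.aestronglyMeasurable 2
  have hint : ∫ z, X z ∂μ = μ.real A := by simp [hX, integral_indicator_one hA]
  have hvarX : ProbabilityTheory.variance X μ ≤ μ.real A := by
    refine (ProbabilityTheory.variance_le_sub_mul_sub (Filter.Eventually.of_forall hX01)
      hXm.aemeasurable).trans ?_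
    rw [hint, sub_zero]
    have h0 : 0 ≤ μ.real A := measureReal_nonneg
    nlinarith
  set S : (ι → Z) → ℝ := ∑ i, fun z => X (z i) with hS
  have hXi : ∀ i : ι, MemLp (fun z : ι → Z => X (z i)) 2 (Measure.pi fun _ : ι => μ) := fun i =>
    hXL.comp_measurePreserving (measurePreserving_eval _ i)
  have hSL : MemLp S 2 (Measure.pi fun _ : ι => μ) := memLp_finsetSum' _ fun i _ => hXi i
  have hSint : ∫ z, S z ∂(Measure.pi fun _ : ι => μ) = Fintype.card ι * μ.real A := by
    simp only [hS, Finset.sum_apply]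
    rw [integral_finsetSum _ fun i _ => (hXi i).integrable (by norm_num)]
    have : ∀ i : ι, ∫ z, X (z i) ∂(Measure.pi fun _ : ι => μ) = μ.real A := fun i => by
      rw [← hint, integral_comp_eval (μ := fun _ : ι => μ) (f := X) hXm.aestronglyMeasurable]
    simp [this]
  have hSvar : ProbabilityTheory.variance S (Measure.pi fun _ : ι => μ) ≤
      Fintype.card ι * μ.real A := by
    rw [hS, ProbabilityTheory.variance_sum_pi (fun _ => hXL)]
    simp only [Finset.sum_const, Finset.card_univ, nsmul_eq_mul]
    gcongr
  have hcard : ∀ z, S z = ((Finset.univ.filter fun i => z i ∈ A).card : ℝ) := by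
    intro z
    simp [hS, hX, Set.indicator_apply]
  have h := ProbabilityTheory.meas_ge_le_variance_div_sq hSL ha
  rw [hSint] at h
  simp only [hcard] at h
  refine h.trans (ENNReal.ofReal_le_ofReal ?_)
  gcongr

/-- Exchanges the two copies of the indices at which `σ` is true. -/
def swapPerm {ι : Type*} (σ : ι → Bool) : Equiv.Perm (ι ⊕ ι) :=
  Function.Involutive.toPerm
    (Sum.elim (fun i => if σ i then Sum.inr i else Sum.inl i)
      (fun i => if σ i then Sum.inl i else Sum.inr i)) (by
    rintro (i | i) <;> cases h : σ i <;> simp [h])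

theorem swapPerm_inl {ι : Type*} (σ : ι → Bool) (i : ι) :
    swapPerm σ (Sum.inl i) = if σ i then Sum.inr i else Sum.inl i := rfl

theorem swapPerm_inr {ι : Type*} (σ : ι → Bool) (i : ι) :
    swapPerm σ (Sum.inr i) = if σ i then Sum.inl i else Sum.inr i := rfl

open Classical in
-- Fix one admissible `σ₀` and let `T` be the indices hit in its second half. There exactly one of
-- the two copies lies in `J`, and an admissible swap must keep it in the second half; so it equals
-- `σ₀` on `T`, which has at least `e` elements.
theorem card_swaps_le {ι : Type*} [Fintype ι] (J : Set (ι ⊕ ι)) (e : ℕ) :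
    (Finset.univ.filter fun σ : ι → Bool => (∀ i, swapPerm σ (Sum.inl i) ∉ J) ∧
      e ≤ (Finset.univ.filter fun i => swapPerm σ (Sum.inr i) ∈ J).card).card * 2 ^ e ≤
      2 ^ Fintype.card ι := by
  by_cases hne : ∃ σ : ι → Bool, (∀ i, swapPerm σ (Sum.inl i) ∉ J) ∧
      e ≤ (Finset.univ.filter fun i => swapPerm σ (Sum.inr i) ∈ J).card
  · obtain ⟨σ₀, -, hσe⟩ := hne
    set T := Finset.univ.filter fun i => swapPerm σ₀ (Sum.inr i) ∈ J with hT
    have hsub : (Finset.univ.filter fun σ : ι → Bool => (∀ i, swapPerm σ (Sum.inl i) ∉ J) ∧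
        e ≤ (Finset.univ.filter fun i => swapPerm σ (Sum.inr i) ∈ J).card) ⊆
        Fintype.piFinset fun i => if i ∈ T then {σ₀ i} else Finset.univ := by
      intro σ hσ
      simp only [Finset.mem_filter, Finset.mem_univ, true_and] at hσ
      rw [Fintype.mem_piFinset]
      intro i
      split_ifs with hi
      · rw [Finset.mem_singleton]
        have h1 : swapPerm σ₀ (Sum.inr i) ∈ J := (Finset.mem_filter.1 hi).2
        have h2 := hσ.1 i
        rw [swapPerm_inr] at h1
        rw [swapPerm_inl] at h2
        cases h3 : σ i <;> cases h4 : σ₀ i <;> simp_all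
      · simp
    have hcard : (Fintype.piFinset fun i => if i ∈ T then {σ₀ i} else Finset.univ).card * 2 ^ e ≤
        2 ^ Fintype.card ι := by
      rw [Fintype.card_piFinset]
      have h1 : ∏ i, (if i ∈ T then {σ₀ i} else (Finset.univ : Finset Bool)).card =
          2 ^ (Finset.univ.filter fun i => i ∉ T).card := by
        rw [← Finset.prod_const, Finset.prod_filter]
        refine Finset.prod_congr rfl fun i _ => ?_
        by_cases hi : i ∈ T <;> simp [hi]
      rw [h1, ← pow_add]
      refine Nat.pow_le_pow_right (by norm_num) ?_
      have h2 := Finset.card_filter_add_card_filter_not (s := (Finset.univ : Finset ι))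
        (fun i => i ∈ T)
      have h3 : (Finset.univ.filter fun i => i ∈ T) = T := by simp
      rw [h3, Finset.card_univ] at h2
      omega
    exact (Nat.mul_le_mul_right _ (Finset.card_le_card hsub)).trans hcard
  · rw [Finset.filter_false_of_mem]
    · simp
    · intro σ _ h
      exact hne ⟨σ, h⟩

open Classical in
/-- The Sauer–Shelah bound for the traces of a family of sets on a sample. -/
theorem card_traces_le {Z κ I : Type*} [Fintype I] (D : κ → Set Z) (z : I → Z) {d : ℕ}
    (hd : ∀ S : Finset I, (∀ T ⊆ S, ∃ h, ∀ i ∈ S, z i ∈ D h ↔ i ∈ T) → S.card ≤ d) :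
    (Finset.univ.filter fun J : Finset I => ∃ h, ∀ i, z i ∈ D h ↔ i ∈ J).card ≤
      ∑ j ∈ Finset.Iic d, (Fintype.card I).choose j := by
  set 𝒜 := Finset.univ.filter fun J : Finset I => ∃ h, ∀ i, z i ∈ D h ↔ i ∈ J with h𝒜
  have hvc : 𝒜.vcDim ≤ d := by
    refine Finset.sup_le fun S hS => hd S fun T hT => ?_
    obtain ⟨J, hJ, hST⟩ := (Finset.mem_shatterer.1 hS) hT
    obtain ⟨h, hh⟩ := (Finset.mem_filter.1 hJ).2
    refine ⟨h, fun i hi => ?_⟩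
    rw [hh, ← hST, Finset.mem_inter]
    exact ⟨fun h => ⟨hi, h⟩, fun h => h.2⟩
  refine (Finset.card_le_card_shatterer 𝒜).trans (Finset.card_shatterer_le_sum_vcDim.trans ?_)
  exact Finset.sum_le_sum_of_subset (Finset.Iic_subset_Iic.2 hvc)

open Classical in
-- For a fixed double sample only the trace of `D h` on it matters, so a union bound over the traces
-- suffices.
theorem card_swaps_exists_le {Z κ ι : Type*} [Fintype ι] (D : κ → Set Z) (z : ι ⊕ ι → Z) {d : ℕ}
    (hd : ∀ S : Finset (ι ⊕ ι), (∀ T ⊆ S, ∃ h, ∀ i ∈ S, z i ∈ D h ↔ i ∈ T) → S.card ≤ d) (e : ℕ) :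
    (Finset.univ.filter fun σ : ι → Bool => ∃ h, (∀ i, z (swapPerm σ (Sum.inl i)) ∉ D h) ∧
      e ≤ (Finset.univ.filter fun i => z (swapPerm σ (Sum.inr i)) ∈ D h).card).card * 2 ^ e ≤
      (∑ j ∈ Finset.Iic d, (2 * Fintype.card ι).choose j) * 2 ^ Fintype.card ι := by
  set 𝒜 := Finset.univ.filter fun J : Finset (ι ⊕ ι) => ∃ h, ∀ i, z i ∈ D h ↔ i ∈ J with h𝒜
  have hsub : (Finset.univ.filter fun σ : ι → Bool => ∃ h,
      (∀ i, z (swapPerm σ (Sum.inl i)) ∉ D h) ∧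
      e ≤ (Finset.univ.filter fun i => z (swapPerm σ (Sum.inr i)) ∈ D h).card) ⊆
      𝒜.biUnion fun J => Finset.univ.filter fun σ : ι → Bool =>
        (∀ i, swapPerm σ (Sum.inl i) ∉ (J : Set (ι ⊕ ι))) ∧
        e ≤ (Finset.univ.filter fun i => swapPerm σ (Sum.inr i) ∈ (J : Set (ι ⊕ ι))).card := by
    intro σ hσ
    obtain ⟨h, h1, h2⟩ := (Finset.mem_filter.1 hσ).2
    refine Finset.mem_biUnion.2 ⟨Finset.univ.filter fun i => z i ∈ D h, ?_, ?_⟩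
    · exact Finset.mem_filter.2 ⟨Finset.mem_univ _, h, fun i => by simp⟩
    · refine Finset.mem_filter.2 ⟨Finset.mem_univ _, fun i => by simpa using h1 i, ?_⟩
      simpa using h2
  have hA := card_traces_le D z hd
  rw [Fintype.card_sum, ← two_mul] at hA
  calc _ ≤ (∑ J ∈ 𝒜, (Finset.univ.filter fun σ : ι → Bool =>
        (∀ i, swapPerm σ (Sum.inl i) ∉ (J : Set (ι ⊕ ι))) ∧
        e ≤ (Finset.univ.filter fun i => swapPerm σ (Sum.inr i) ∈ (J : Set (ι ⊕ ι))).card).card)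
          * 2 ^ e := by
        gcongr
        exact (Finset.card_le_card hsub).trans Finset.card_biUnion_le
    _ ≤ ∑ J ∈ 𝒜, 2 ^ Fintype.card ι := by
        rw [Finset.sum_mul]
        refine Finset.sum_le_sum fun J _ => ?_
        convert! card_swaps_le (J : Set (ι ⊕ ι)) e
    _ ≤ _ := by
        rw [Finset.sum_const, smul_eq_mul]
        gcongr

open Classical in
/-- Symmetrization: with high probability no member of the family misses the first half of a sample
and is hit `e` times by the second half. -/
theorem measure_pi_exists_miss_and_hit_le {Z κ ι : Type*} [MeasurableSpace Z] [Fintype ι]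
    (μ : Measure Z) [IsProbabilityMeasure μ] (D : κ → Set Z) {d e : ℕ}
    (hd : ∀ (z : ι ⊕ ι → Z) (S : Finset (ι ⊕ ι)),
      (∀ T ⊆ S, ∃ h, ∀ i ∈ S, z i ∈ D h ↔ i ∈ T) → S.card ≤ d)
    (hmeas : NullMeasurableSet {z : ι ⊕ ι → Z | ∃ h, (∀ i, z (Sum.inl i) ∉ D h) ∧
      e ≤ (Finset.univ.filter fun i => z (Sum.inr i) ∈ D h).card} (Measure.pi fun _ => μ)) :
    (Measure.pi fun _ => μ) {z : ι ⊕ ι → Z | ∃ h, (∀ i, z (Sum.inl i) ∉ D h) ∧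
      e ≤ (Finset.univ.filter fun i => z (Sum.inr i) ∈ D h).card} * 2 ^ e ≤
      ((∑ j ∈ Finset.Iic d, (2 * Fintype.card ι).choose j : ℕ) : ENNReal) := by
  set E := {z : ι ⊕ ι → Z | ∃ h, (∀ i, z (Sum.inl i) ∉ D h) ∧
      e ≤ (Finset.univ.filter fun i => z (Sum.inr i) ∈ D h).card} with hE
  set P : Measure (ι ⊕ ι → Z) := Measure.pi fun _ => μ with hP
  set G := ∑ j ∈ Finset.Iic d, (2 * Fintype.card ι).choose j with hG
  have hmp : ∀ σ : ι → Bool, MeasurePreserving (fun (z : ι ⊕ ι → Z) i => z (swapPerm σ i)) P P := by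
    intro σ
    have h := (measurePreserving_piCongrLeft (α := fun _ : ι ⊕ ι => Z) (fun _ => μ)
      (swapPerm σ)).symm
    exact h
  -- The law of the double sample is invariant under every swap, so `P E` is the average over all
  -- swaps, which is bounded for each sample separately.
  have h1 : ∀ σ : ι → Bool, P E = ∫⁻ z, E.indicator 1 (fun i => z (swapPerm σ i)) ∂P := by
    intro σ
    rw [← (hmp σ).measure_preimage hmeas, ← lintegral_indicator_one₀
      (hmeas.preimage (hmp σ).quasiMeasurePreserving)]
    rfl
  have h2 : (2 : ENNReal) ^ Fintype.card ι * P E =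
      ∫⁻ z, ∑ σ : ι → Bool, E.indicator 1 (fun i => z (swapPerm σ i)) ∂P := by
    rw [lintegral_finsetSum']
    · rw [← Finset.sum_congr rfl fun σ _ => h1 σ]
      simp
    · intro σ _
      exact (aemeasurable_indicator_const_iff 1 |>.2
        (hmeas.preimage (hmp σ).quasiMeasurePreserving) :
        AEMeasurable (((fun (z : ι ⊕ ι → Z) i => z (swapPerm σ i)) ⁻¹' E).indicator
          fun _ => (1 : ENNReal)) P)
  have h3 : ∀ z : ι ⊕ ι → Z, (∑ σ : ι → Bool, E.indicator (1 : (ι ⊕ ι → Z) → ENNReal)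
      (fun i => z (swapPerm σ i))) * 2 ^ e ≤ (G : ENNReal) * 2 ^ Fintype.card ι := by
    intro z
    have h4 : (∑ σ : ι → Bool, E.indicator (1 : (ι ⊕ ι → Z) → ENNReal)
        (fun i => z (swapPerm σ i))) = (((Finset.univ.filter fun σ : ι → Bool => ∃ h,
        (∀ i, z (swapPerm σ (Sum.inl i)) ∉ D h) ∧
        e ≤ (Finset.univ.filter fun i => z (swapPerm σ (Sum.inr i)) ∈ D h).card).card : ℕ) :
          ENNReal) := by
      rw [← Finset.sum_boole]
      refine Finset.sum_congr rfl fun σ _ => ?_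
      simp only [Set.indicator_apply, hE, Set.mem_ofPred_eq, Pi.one_apply]
    rw [h4]
    exact_mod_cast card_swaps_exists_le D z (hd z) e
  have h5 : (2 : ENNReal) ^ Fintype.card ι * (P E * 2 ^ e) ≤
      2 ^ Fintype.card ι * (G : ENNReal) := by
    rw [← mul_assoc, h2, ← lintegral_mul_const' _ _ (by simp)]
    calc _ ≤ ∫⁻ _, (G : ENNReal) * 2 ^ Fintype.card ι ∂P := lintegral_mono h3
      _ = _ := by simp [mul_comm]
  exact (ENNReal.mul_le_mul_iff_right (by simp) (by simp)).1 h5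

open Classical in
/-- The ε-net theorem: a sample is likely to hit all members of a family of sets of measure at
least `γ`. -/
theorem measure_pi_exists_miss_le {Z κ ι : Type*} [MeasurableSpace Z] [Fintype ι]
    (μ : Measure Z) [IsProbabilityMeasure μ] (D : κ → Set Z) {d e : ℕ}
    (hd : ∀ (z : ι ⊕ ι → Z) (S : Finset (ι ⊕ ι)),
      (∀ T ⊆ S, ∃ h, ∀ i ∈ S, z i ∈ D h ↔ i ∈ T) → S.card ≤ d)
    (hmeas : NullMeasurableSet {z : ι ⊕ ι → Z | ∃ h, (∀ i, z (Sum.inl i) ∉ D h) ∧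
      e ≤ (Finset.univ.filter fun i => z (Sum.inr i) ∈ D h).card} (Measure.pi fun _ => μ))
    (hD : ∀ h, MeasurableSet (D h)) {γ : ℝ} (hγ : ∀ h, γ ≤ μ.real (D h))
    (he : (e : ℝ) ≤ γ * Fintype.card ι / 2) (hn : 8 ≤ γ * Fintype.card ι) :
    (Measure.pi fun _ => μ) {z : ι → Z | ∃ h, ∀ i, z i ∉ D h} * 2 ^ e ≤
      2 * ((∑ j ∈ Finset.Iic d, (2 * Fintype.card ι).choose j : ℕ) : ENNReal) := by
  set P : Measure (ι → Z) := Measure.pi fun _ => μ with hP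
  -- The mean number of hits is at least `8` and `e` is at most half of the mean, so Chebyshev
  -- bounds the failure by `4 / 8`.
  have hhalf : ∀ h, (2 : ENNReal)⁻¹ ≤
      P {z | e ≤ (Finset.univ.filter fun i => z i ∈ D h).card} := by
    intro h
    have hp : 8 ≤ Fintype.card ι * μ.real (D h) := by
      have := mul_le_mul_of_nonneg_right (hγ h) (Nat.cast_nonneg (Fintype.card ι))
      linarith
    have hp2 : (e : ℝ) ≤ Fintype.card ι * μ.real (D h) / 2 := by
      have := mul_le_mul_of_nonneg_right (hγ h) (Nat.cast_nonneg (Fintype.card ι))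
      linarith
    have h1 := measure_pi_le_abs_card_sub (ι := ι) μ (hD h)
      (a := Fintype.card ι * μ.real (D h) / 2) (by linarith)
    have hcm : Measurable fun z : ι → Z => (Finset.univ.filter fun i => z i ∈ D h).card := by
      simp only [Finset.card_filter]
      refine Finset.measurable_sum _ fun i _ => ?_
      exact Measurable.ite ((measurable_pi_apply i) (hD h)) measurable_const measurable_const
    have hms : MeasurableSet {z : ι → Z | e ≤ (Finset.univ.filter fun i => z i ∈ D h).card} :=
      measurableSet_le measurable_const hcm
    have h2 : P {z : ι → Z | e ≤ (Finset.univ.filter fun i => z i ∈ D h).card}ᶜ ≤ 2⁻¹ := by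
      refine (measure_mono ?_).trans (h1.trans ?_)
      · intro z hz
        simp only [Set.mem_compl_iff, Set.mem_ofPred_eq, not_le] at hz ⊢
        have hz' : ((Finset.univ.filter fun i => z i ∈ D h).card : ℝ) < e := by exact_mod_cast hz
        rw [abs_sub_comm]
        refine le_trans ?_ (le_abs_self _)
        linarith
      · refine ENNReal.ofReal_le_of_le_toReal ?_
        rw [ENNReal.toReal_inv, ENNReal.toReal_ofNat, div_le_iff₀ (by positivity)]
        nlinarith
    rw [prob_compl_eq_one_sub hms] at h2
    have h3 := tsub_le_iff_right.1 h2
    rw [← ENNReal.inv_two_add_inv_two] at h3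
    exact (ENNReal.add_le_add_iff_left (by simp)).1 h3
  set F : Set ((ι → Z) × (ι → Z)) := {p | ∃ h, (∀ i, p.1 i ∉ D h) ∧
      e ≤ (Finset.univ.filter fun i => p.2 i ∈ D h).card} with hF
  have h1 := measure_pi_exists_miss_and_hit_le μ D hd hmeas
  have h2 : (Measure.pi fun _ => μ) {z : ι ⊕ ι → Z | ∃ h, (∀ i, z (Sum.inl i) ∉ D h) ∧
      e ≤ (Finset.univ.filter fun i => z (Sum.inr i) ∈ D h).card} = (P.prod P) F := by
    have h3 := measurePreserving_sumPiEquivProdPi (X := fun _ : ι ⊕ ι => Z) (fun _ => μ)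
    rw [← h3.measure_preimage_equiv]
    rfl
  rw [h2] at h1
  -- Given a first half missed by `D h`, the second half hits this `D h` often with probability at
  -- least one half. The measurable hull of `F` permits Tonelli, and the miss event needs no
  -- measurability.
  have h4 : 2⁻¹ * P {z : ι → Z | ∃ h, ∀ i, z i ∉ D h} ≤ (P.prod P) F := by
    set F' := toMeasurable (P.prod P) F with hF'
    rw [← measure_toMeasurable (μ := P.prod P) F, Measure.prod_apply (measurableSet_toMeasurable _ _)]
    refine le_trans ?_ (mul_meas_ge_le_lintegral
      (measurable_measure_prodMk_left (measurableSet_toMeasurable _ _)) 2⁻¹)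
    gcongr
    rintro ⟨h, hz⟩
    refine (hhalf h).trans (measure_mono fun y hy => ?_)
    exact subset_toMeasurable _ _ ⟨h, hz, hy⟩
  calc _ = 2 * ((2⁻¹ * P {z : ι → Z | ∃ h, ∀ i, z i ∉ D h}) * 2 ^ e) := by
        rw [← mul_assoc, ← mul_assoc (2 : ENNReal), ENNReal.mul_inv_cancel (by simp) (by simp), one_mul]
    _ ≤ 2 * ((P.prod P) F * 2 ^ e) := by gcongr
    _ ≤ _ := by gcongr

/-- The usual device: weighting by `(2w)^(d - j) ≥ 1` and completing the sum gives `(2w)^d (1 +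
1/(2w))^(2dw)`, where the second factor is at most `exp d ≤ 3^d`. -/
theorem sum_Iic_choose_le {d w : ℕ} (hw : 1 ≤ w) :
    ((∑ j ∈ Finset.Iic d, (2 * (d * w)).choose j : ℕ) : ℝ) ≤ (6 * w) ^ d := by
  have hw0 : (0 : ℝ) < w := by exact_mod_cast hw
  have hy : (1 : ℝ) ≤ 2 * w := by
    have : (1 : ℝ) ≤ w := by exact_mod_cast hw
    linarith
  by_cases hd : d ≤ 2 * (d * w)
  swap
  · nlinarith
  have h1 : ((∑ j ∈ Finset.Iic d, (2 * (d * w)).choose j : ℕ) : ℝ) ≤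
      (2 * w) ^ d * ∑ j ∈ Finset.range (2 * (d * w) + 1),
        (1 / (2 * w) : ℝ) ^ j * 1 ^ (2 * (d * w) - j) * (2 * (d * w)).choose j := by
    rw [Finset.mul_sum]
    push_cast
    calc ∑ j ∈ Finset.Iic d, ((2 * (d * w)).choose j : ℝ)
        ≤ ∑ j ∈ Finset.Iic d, (2 * w : ℝ) ^ d *
          ((1 / (2 * w) : ℝ) ^ j * 1 ^ (2 * (d * w) - j) * (2 * (d * w)).choose j) := by
          refine Finset.sum_le_sum fun j hj => ?_
          have hjd : j ≤ d := Finset.mem_Iic.1 hj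
          rw [one_pow, mul_one, ← mul_assoc ((2 * w : ℝ) ^ d)]
          refine le_mul_of_one_le_left (Nat.cast_nonneg _) ?_
          rw [one_div, inv_pow, ← div_eq_mul_inv, one_le_div (by positivity)]
          exact pow_le_pow_right₀ hy hjd
      _ ≤ _ := by
          refine Finset.sum_le_sum_of_subset_of_nonneg ?_ fun _ _ _ => by positivity
          intro j hj
          have hjd : j ≤ d := Finset.mem_Iic.1 hj
          exact Finset.mem_range.2 (by omega)
  rw [← add_pow] at h1
  refine h1.trans ?_
  have h2 : (1 / (2 * (w : ℝ)) + 1 : ℝ) ^ (2 * (d * w)) ≤ 3 ^ d := by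
    have h3 : (1 / (2 * w) + 1 : ℝ) ≤ Real.exp (1 / (2 * w)) := Real.add_one_le_exp _
    calc (1 / (2 * w) + 1 : ℝ) ^ (2 * (d * w)) ≤ Real.exp (1 / (2 * w)) ^ (2 * (d * w)) := by
          gcongr
      _ = Real.exp 1 ^ d := by
          rw [← Real.exp_nat_mul, ← Real.exp_nat_mul]
          congr 1
          push_cast
          field_simp
      _ ≤ 3 ^ d := by
          gcongr
          exact (Real.exp_one_lt_d9.trans (by norm_num)).le
  calc _ ≤ (2 * w : ℝ) ^ d * 3 ^ d := by gcongr
    _ = (6 * w) ^ d := by rw [← mul_pow]; ring_nf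

/-! ### Hits of a window by blocks of sample points. -/

/-- `z t` is the only point of the block `z` in the window `(w, w + δ)`. -/
def IsHit {b : ℕ} (δ w : ℝ) (z : Fin b → ℝ) (t : Fin b) : Prop :=
  z t ∈ Set.Ioo w (w + δ) ∧ ∀ s, s ≠ t → z s ∉ Set.Ioo w (w + δ)

theorem IsHit.unique {b : ℕ} {δ w : ℝ} {z : Fin b → ℝ} {t t' : Fin b} (h : IsHit δ w z t)
    (h' : IsHit δ w z t') : t = t' := by
  by_contra hne
  exact h'.2 t hne h.1

theorem measurableSet_isHit {X : Type*} [MeasurableSpace X] {b : ℕ} (δ : ℝ) {w : X → ℝ}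
    {z : X → Fin b → ℝ} (hw : Measurable w) (hz : Measurable z) (t : Fin b) :
    MeasurableSet {x | IsHit δ (w x) (z x) t} := by
  have h : ∀ s, MeasurableSet {x | z x s ∈ Set.Ioo (w x) (w x + δ)} := fun s =>
    (measurableSet_lt hw ((measurable_pi_apply s).comp hz)).inter
      (measurableSet_lt ((measurable_pi_apply s).comp hz) (hw.add_const δ))
  have : {x | IsHit δ (w x) (z x) t} = {x | z x t ∈ Set.Ioo (w x) (w x + δ)} ∩
      ⋂ s, ⋂ (_ : s ≠ t), {x | z x s ∈ Set.Ioo (w x) (w x + δ)}ᶜ := by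
    ext x
    simp [IsHit]
  rw [this]
  exact (h t).inter (MeasurableSet.iInter fun s => MeasurableSet.iInter fun _ => (h s).compl)

/-- The blocks of `b` points whose hit of the window exists and shows that `f` and `h` differ. -/
def hitDisagreement {Y : Type u} (f : ℝ → Y) (b : ℕ) (δ w : ℝ) (h : ℝ → Y) : Set (Fin b → ℝ) :=
  {z | ∃ t, IsHit δ w z t ∧ f (z t) ≠ h (z t)}

theorem hitDisagreement_eq {Y : Type u} (f : ℝ → Y) (b : ℕ) (δ w : ℝ) (h : ℝ → Y) :
    hitDisagreement f b δ w h = ⋃ t ∈ (Finset.univ : Finset (Fin b)), Set.univ.pi fun s =>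
      if s = t then {x | f x ≠ h x} ∩ Set.Ioo w (w + δ) else (Set.Ioo w (w + δ))ᶜ := by
  ext z
  simp only [hitDisagreement, IsHit, Set.mem_ofPred_eq, Finset.mem_univ, Set.iUnion_true,
    Set.mem_iUnion, Set.mem_univ_pi]
  refine exists_congr fun t => ⟨fun ⟨⟨h1, h2⟩, h3⟩ s => ?_, fun hz => ⟨⟨?_, fun s hs => ?_⟩, ?_⟩⟩
  · by_cases hs : s = t
    · subst hs
      simpa using ⟨h3, h1⟩
    · rw [if_neg hs]
      exact h2 s hs
  · have := hz t
    rw [if_pos rfl] at this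
    exact this.2
  · have := hz s
    rwa [if_neg hs] at this
  · have := hz t
    rw [if_pos rfl] at this
    exact this.1

theorem measurableSet_univ_pi_hit {Y : Type u} {f h : ℝ → Y} (hfh : MeasurableSet {x | f x ≠ h x})
    {b : ℕ} (δ w : ℝ) (t : Fin b) : MeasurableSet (Set.univ.pi fun s : Fin b =>
      if s = t then {x | f x ≠ h x} ∩ Set.Ioo w (w + δ) else (Set.Ioo w (w + δ))ᶜ) := by
  refine MeasurableSet.univ_pi fun s => ?_
  split_ifs
  · exact hfh.inter measurableSet_Ioo
  · exact measurableSet_Ioo.compl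

theorem measurableSet_hitDisagreement {Y : Type u} {f h : ℝ → Y}
    (hfh : MeasurableSet {x | f x ≠ h x}) (b : ℕ) (δ w : ℝ) :
    MeasurableSet (hitDisagreement f b δ w h) := by
  rw [hitDisagreement_eq]
  exact Finset.measurableSet_biUnion _ fun t _ => measurableSet_univ_pi_hit hfh δ w t

/-- The `b` boxes of `hitDisagreement_eq` are disjoint because a hit is unique. In each, one point
falls where `f` and `h` differ and the others avoid the window, which lies inside `(0,1)`. -/
theorem le_measureReal_hitDisagreement {Y : Type u} {f h : ℝ → Y}
    (hfh : MeasurableSet {x | f x ≠ h x}) (b : ℕ) {δ w c : ℝ} (hδ : 0 < δ)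
    (hw : w ∈ Set.Ioo 0 (1 - δ))
    (hc : ENNReal.ofReal c ≤ volume ({x | f x ≠ h x} ∩ Set.Ioo w (w + δ))) :
    b * (c * (1 - δ) ^ (b - 1)) ≤
      (Measure.pi fun _ : Fin b => uniform01).real (hitDisagreement f b δ w h) := by
  have hW : Set.Ioo w (w + δ) ⊆ Set.Ioo 0 1 := by
    rintro x ⟨h1, h2⟩
    exact ⟨hw.1.trans h1, by linarith [hw.2]⟩
  have hδ1 : 0 ≤ 1 - δ := (hw.1.trans hw.2).le
  have hA : c ≤ uniform01.real ({x | f x ≠ h x} ∩ Set.Ioo w (w + δ)) := by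
    refine (ENNReal.ofReal_le_iff_le_toReal (measure_ne_top _ _)).1 ?_
    rw [uniform01, Measure.restrict_apply' measurableSet_Ioo,
      Set.inter_eq_left.2 (Set.inter_subset_right.trans hW)]
    exact hc
  have hB : uniform01.real (Set.Ioo w (w + δ))ᶜ = 1 - δ := by
    rw [probReal_compl_eq_one_sub measurableSet_Ioo]
    congr 1
    rw [uniform01, measureReal_restrict_apply measurableSet_Ioo, Set.inter_eq_left.2 hW,
      Real.volume_real_Ioo_of_le (by linarith)]
    ring
  rw [hitDisagreement_eq, measureReal_biUnion_finset]
  · have hsum : (b : ℝ) * (c * (1 - δ) ^ (b - 1)) =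
        ∑ _t ∈ (Finset.univ : Finset (Fin b)), c * (1 - δ) ^ (b - 1) := by simp
    rw [hsum]
    refine Finset.sum_le_sum fun t _ => ?_
    have h1 : (Measure.pi fun _ : Fin b => uniform01).real (Set.univ.pi fun s =>
        if s = t then {x | f x ≠ h x} ∩ Set.Ioo w (w + δ) else (Set.Ioo w (w + δ))ᶜ) =
        uniform01.real ({x | f x ≠ h x} ∩ Set.Ioo w (w + δ)) * (1 - δ) ^ (b - 1) := by
      rw [Measure.real, Measure.pi_pi, ENNReal.toReal_prod,
        ← Finset.mul_prod_erase _ _ (Finset.mem_univ t), if_pos rfl]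
      congr 1
      rw [Finset.prod_congr rfl (g := fun _ => 1 - δ)]
      · simp
      · intro s hs
        rw [if_neg (Finset.ne_of_mem_erase hs)]
        exact hB
    rw [h1]
    gcongr
  · intro t _ t' _ htt
    refine Set.disjoint_left.2 fun z hz hz' => htt ?_
    by_contra hne
    have h1 := Set.mem_univ_pi.1 hz t
    have h2 := Set.mem_univ_pi.1 hz' t
    rw [if_pos rfl] at h1
    rw [if_neg hne] at h2
    exact h2 h1.2
  · exact fun t _ => measurableSet_univ_pi_hit hfh δ w t

theorem card_le_of_familyShatters {Z : Type v} {C : Set (Set Z)} {d : ℕ} (hC : familyVCDim C = d)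
    {S : Finset Z} (hS : FamilyShatters C S) : S.card ≤ d := by
  have h : (S.card : ℕ∞) ≤ familyVCDim C :=
    le_iSup₂ (f := fun (S : Finset Z) (_ : FamilyShatters C S) => (S.card : ℕ∞)) S hS
  rw [hC] at h
  exact_mod_cast h

/-- The graph dimension bounds the dimension of the family of the disagreement sets. -/
theorem card_le_of_shatters_hitDisagreement {Y : Type u} {H : Set (ℝ → Y)} {d : ℕ}
    (hd : graphDim H = d) (f : ℝ → Y) {b : ℕ} {δ w : ℝ} {I : Type*} (z : I → Fin b → ℝ)
    (S : Finset I) (hS : ∀ T ⊆ S, ∃ h : H, ∀ i ∈ S, z i ∈ hitDisagreement f b δ w h ↔ i ∈ T) :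
    S.card ≤ d := by
  classical
  have hhit : ∀ i ∈ S, ∃ t, IsHit δ w (z i) t := by
    obtain ⟨h, hh⟩ := hS S subset_rfl
    intro i hi
    obtain ⟨t, ht, -⟩ := (hh i hi).2 hi
    exact ⟨t, ht⟩
  rcases S.eq_empty_or_nonempty with rfl | ⟨i₀, hi₀⟩
  · simp
  have : Nonempty (Fin b) := ⟨(hhit i₀ hi₀).choose⟩
  choose! t ht using hhit
  -- A hit turns a block into a point on the graph of `f`; the block shows disagreement with `h`
  -- exactly when the graph of `h` misses this point.
  set p : I → ℝ × Y := fun i => (z i (t i), f (z i (t i))) with hp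
  have hmem : ∀ i ∈ S, ∀ h : ℝ → Y, z i ∈ hitDisagreement f b δ w h ↔ ¬ (p i).2 = h (p i).1 := by
    intro i hi h
    constructor
    · rintro ⟨t', ht', hne⟩
      rwa [ht'.unique (ht i hi)] at hne
    · exact fun hne => ⟨t i, ht i hi, hne⟩
  have hinj : Set.InjOn p S := by
    intro i hi j hj hij
    by_contra hne
    obtain ⟨h, hh⟩ := hS {i} (by simpa using hi)
    have h1 := (hmem i hi h).1 ((hh i hi).2 (by simp))
    rw [hij] at h1
    have h2 := (hh j hj).1 ((hmem j hj h).2 h1)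
    exact hne (Finset.mem_singleton.1 h2).symm
  rw [← Finset.card_image_of_injOn hinj]
  refine card_le_of_familyShatters hd fun T hT => ?_
  -- Disagreement is the complement of lying on the graph, so the complementary subset is requested.
  obtain ⟨h, hh⟩ := hS (S.filter fun i => p i ∉ T) (Finset.filter_subset _ _)
  refine ⟨_, ⟨h, h.2, rfl⟩, ?_⟩
  have key : ∀ i ∈ S, (p i).2 = (h : ℝ → Y) (p i).1 ↔ p i ∈ T := by
    intro i hi
    have := hh i hi
    rw [hmem i hi h, Finset.mem_filter] at this
    tauto
  ext q
  simp only [Set.mem_inter_iff, Set.mem_ofPred_eq, Finset.coe_image, Set.mem_image]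
  constructor
  · rintro ⟨h1, i, hi, rfl⟩
    exact (key i hi).1 h1
  · intro hq
    have hq' := hT hq
    rw [Finset.coe_image] at hq'
    obtain ⟨i, hi, rfl⟩ := hq'
    exact ⟨(key i hi).2 hq, i, hi, rfl⟩

/-! ### Measurability, and samples as samples of blocks. -/

/-- An event which is decided by the agreement pattern of some member of `H` with `f`. -/
theorem nullMeasurableSet_exists_trace {Y : Type u} [MeasurableSpace Y] {P : Measure ℝ}
    {H : Set (ℝ → Y)} (hT : TraceMeasurable P H) {f : ℝ → Y} (hf : Measurable f)
    {X : Type*} [MeasurableSpace X] {Q : Measure X} {n : ℕ} {π : X → Fin n → ℝ}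
    (hπ : Measure.QuasiMeasurePreserving π Q (Measure.pi fun _ => P)) (Φ : Set (Fin n) → X → Prop)
    (hΦ : ∀ J, NullMeasurableSet {x | Φ J x} Q) :
    NullMeasurableSet {x | ∃ h ∈ H, Φ {i | h (π x i) = f (π x i)} x} Q := by
  -- There are only finitely many patterns `J`, which replaces the union over `H` by a finite one.
  have : {x | ∃ h ∈ H, Φ {i | h (π x i) = f (π x i)} x} = ⋃ J : Set (Fin n),
      (π ⁻¹' {y | ∃ h ∈ H, ∀ i, h (y i) = f (y i) ↔ i ∈ J}) ∩ {x | Φ J x} := by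
    ext x
    simp only [Set.mem_ofPred_eq, Set.mem_iUnion, Set.mem_inter_iff, Set.mem_preimage]
    constructor
    · rintro ⟨h, hh, hx⟩
      exact ⟨_, ⟨h, hh, fun i => Iff.rfl⟩, hx⟩
    · rintro ⟨J, ⟨h, hh, hJ⟩, hx⟩
      refine ⟨h, hh, ?_⟩
      have : {i | h (π x i) = f (π x i)} = J := Set.ext hJ
      rwa [this]
  rw [this]
  exact NullMeasurableSet.iUnion fun J => ((hT f hf n J).preimage hπ).inter (hΦ J)

open Classical in
theorem nullMeasurableSet_le_card_filter {X ι : Type*} [MeasurableSpace X] [Fintype ι]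
    {Q : Measure X} {p : ι → X → Prop} (hp : ∀ i, NullMeasurableSet {x | p i x} Q) (e : ℕ) :
    NullMeasurableSet {x | e ≤ (Finset.univ.filter fun i => p i x).card} Q := by
  have : {x | e ≤ (Finset.univ.filter fun i => p i x).card} =
      ⋃ T : Finset ι, ⋃ (_ : e ≤ T.card), ⋂ i, ⋂ (_ : i ∈ T), {x | p i x} := by
    ext x
    simp only [Set.mem_ofPred_eq, Set.mem_iUnion, Set.mem_iInter]
    constructor
    · intro h
      exact ⟨_, h, fun i hi => (Finset.mem_filter.1 hi).2⟩
    · rintro ⟨T, hT, h⟩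
      exact hT.trans (Finset.card_le_card fun i hi =>
        Finset.mem_filter.2 ⟨Finset.mem_univ _, h i hi⟩)
  rw [this]
  exact NullMeasurableSet.iUnion fun T => NullMeasurableSet.iUnion fun _ =>
    NullMeasurableSet.iInter fun i => NullMeasurableSet.iInter fun _ => hp i

theorem measurePreserving_blocks {ι κ I : Type*} [Fintype ι] [Fintype κ] [Fintype I]
    (e : ι × κ ≃ I) (μ : Measure ℝ) [IsProbabilityMeasure μ] :
    MeasurePreserving (fun (x : I → ℝ) (i : ι) (j : κ) => x (e (i, j)))
      (Measure.pi fun _ => μ) (Measure.pi fun _ => Measure.pi fun _ => μ) := by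
  have h1 : MeasurePreserving (fun (x : I → ℝ) (p : ι × κ) => x (e p))
      (Measure.pi fun _ => μ) (Measure.pi fun _ => μ) :=
    (measurePreserving_piCongrLeft (α := fun _ : I => ℝ) (fun _ => μ) e).symm
  have h2 : MeasurePreserving (MeasurableEquiv.curry ι κ ℝ)
      (Measure.pi fun _ => μ) (Measure.pi fun _ => Measure.pi fun _ => μ) := by
    refine ⟨MeasurableEquiv.measurable _, ?_⟩
    have := Measure.infinitePi_map_curry (ι := ι) (κ := κ) (X := ℝ) (fun _ _ => μ)
    simpa only [Measure.infinitePi_eq_pi] using this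
  exact h2.comp h1

/-- Needed to apply the measurability convention, which speaks of samples of points, to events about
blocks. -/
theorem measurePreserving_unblock {ι κ I : Type*} [Fintype ι] [Fintype κ] [Fintype I]
    (e : ι × κ ≃ I) (μ : Measure ℝ) [IsProbabilityMeasure μ] :
    MeasurePreserving (fun (z : ι → κ → ℝ) (i : I) => z (e.symm i).1 (e.symm i).2)
      (Measure.pi fun _ => Measure.pi fun _ => μ) (Measure.pi fun _ => μ) := by
  have h1 : MeasurePreserving (fun (x : ι × κ → ℝ) (i : I) => x (e.symm i))
      (Measure.pi fun _ => μ) (Measure.pi fun _ => μ) :=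
    (measurePreserving_piCongrLeft (α := fun _ : ι × κ => ℝ) (fun _ => μ) e.symm).symm
  have h2 : MeasurePreserving (MeasurableEquiv.curry ι κ ℝ).symm
      (Measure.pi fun _ => Measure.pi fun _ => μ) (Measure.pi fun _ => μ) := by
    refine ⟨MeasurableEquiv.measurable _, ?_⟩
    have := Measure.infinitePi_map_curry_symm (ι := ι) (κ := κ) (X := ℝ) (fun _ _ => μ)
    simpa only [Measure.infinitePi_eq_pi] using this
  exact h1.comp h2

/-! ### Detection of far windows, and the choice of parameters. -/

open Classical in
/-- A far window is likely to be detected by the hits of a sample of blocks. -/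
theorem measure_pi_exists_consistent_le {Y : Type u} [MeasurableSpace Y]
    (hY : MeasurableDisagreement Y) {H : Set (ℝ → Y)} (hH : ∀ h ∈ H, Measurable h)
    (hT : TraceMeasurable uniform01 H) {d : ℕ} (hd : graphDim H = d) {f : ℝ → Y}
    (hf : Measurable f) {M b e : ℕ} {δ c w : ℝ} (hδ : 0 < δ) (hw : w ∈ farSet H f δ c)
    (he : (e : ℝ) ≤ b * (c * (1 - δ) ^ (b - 1)) * M / 2)
    (hM : 8 ≤ b * (c * (1 - δ) ^ (b - 1)) * M) :
    (Measure.pi fun _ => Measure.pi fun _ => uniform01) {z : Fin M → Fin b → ℝ |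
      ∃ h ∈ H, ∀ j t, IsHit δ w (z j) t → h (z j t) = f (z j t)} * 2 ^ e ≤
      2 * ((∑ j ∈ Finset.Iic d, (2 * M).choose j : ℕ) : ENNReal) := by
  have hfh : ∀ h : H, MeasurableSet {x | f x ≠ (h : ℝ → Y) x} := fun h => hY f h hf (hH h h.2)
  have key := measure_pi_exists_miss_le (ι := Fin M) (d := d) (e := e)
    (Measure.pi fun _ : Fin b => uniform01)
    (fun h : H => hitDisagreement f b δ w h)
    (fun z S hS => card_le_of_shatters_hitDisagreement hd f z S hS) ?_
    (fun h => measurableSet_hitDisagreement (hfh h) b δ w)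
    (γ := b * (c * (1 - δ) ^ (b - 1)))
    (fun h => le_measureReal_hitDisagreement (hfh h) b hδ hw.1
      (not_lt.1 fun hlt => hw.2 h ⟨h.2, hlt⟩))
    (by simpa using he) (by simpa using hM)
  · rw [Fintype.card_fin] at key
    refine le_trans (le_of_eq ?_) key
    congr 2
    ext z
    simp only [Set.mem_ofPred_eq, hitDisagreement, Subtype.exists, not_exists, not_and, not_not,
      exists_prop]
    refine exists_congr fun h => and_congr_right fun _ => forall_congr' fun j =>
      forall_congr' fun t => imp_congr_right fun _ => eq_comm
  -- The event depends on the hits, which are measurable, and on the agreement pattern of `h` with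
  -- `f` on all points of the double sample.
  · set n := Fintype.card ((Fin M ⊕ Fin M) × Fin b)
    set E : (Fin M ⊕ Fin M) × Fin b ≃ Fin n := Fintype.equivFin _
    have hit : ∀ (i : Fin M ⊕ Fin M) (t : Fin b),
        MeasurableSet {z : Fin M ⊕ Fin M → Fin b → ℝ | IsHit δ w (z i) t} := fun i t =>
      measurableSet_isHit δ measurable_const (measurable_pi_apply i) t
    have hdis : ∀ (J : Set (Fin n)) (i : Fin M ⊕ Fin M), MeasurableSet
        {z : Fin M ⊕ Fin M → Fin b → ℝ | ∃ t, IsHit δ w (z i) t ∧ E (i, t) ∉ J} := by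
      intro J i
      rw [Set.ofPred_exists]
      exact MeasurableSet.iUnion fun t => (hit i t).inter (MeasurableSet.const _)
    have h := nullMeasurableSet_exists_trace hT hf
      (measurePreserving_unblock E uniform01).quasiMeasurePreserving
      (fun J z => (∀ i, ¬ ∃ t, IsHit δ w (z (Sum.inl i)) t ∧ E (Sum.inl i, t) ∉ J) ∧
        e ≤ (Finset.univ.filter fun i =>
          ∃ t, IsHit δ w (z (Sum.inr i)) t ∧ E (Sum.inr i, t) ∉ J).card) ?_
    · convert! h using 1
      ext z
      have hk : ∀ (h : ℝ → Y) (i : Fin M ⊕ Fin M), z i ∈ hitDisagreement f b δ w h ↔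
          ∃ t, IsHit δ w (z i) t ∧ E (i, t) ∉
            {p | h (z (E.symm p).1 (E.symm p).2) = f (z (E.symm p).1 (E.symm p).2)} := by
        intro h i
        simp [hitDisagreement, eq_comm]
      constructor
      · rintro ⟨h, h1, h2⟩
        exact ⟨h, h.2, fun i hi => h1 i ((hk h _).2 hi), h2.trans (Finset.card_le_card fun i hi =>
          Finset.mem_filter.2 ⟨Finset.mem_univ _, (hk h _).1 (Finset.mem_filter.1 hi).2⟩)⟩
      · rintro ⟨h, hh, h1, h2⟩
        exact ⟨⟨h, hh⟩, fun i hi => h1 i ((hk h _).1 hi), h2.trans (Finset.card_le_card fun i hi =>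
          Finset.mem_filter.2 ⟨Finset.mem_univ _, (hk h _).2 (Finset.mem_filter.1 hi).2⟩)⟩
    · intro J
      rw [Set.ofPred_and]
      refine NullMeasurableSet.inter ?_ ?_
      · rw [Set.ofPred_forall]
        exact NullMeasurableSet.iInter fun i => (hdis J (Sum.inl i)).compl.nullMeasurableSet
      · convert! nullMeasurableSet_le_card_filter
          (fun i => (hdis J (Sum.inr i)).nullMeasurableSet) e

/-- A function which is far from the `k`-piecewise class has more far windows than the breakpoints
of a `k`-piecewise function can account for. -/
theorem le_volume_farSet_of_le_distToClass {Y : Type u} {H : Set (ℝ → Y)} (hne : H.Nonempty)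
    (hZ : ZeroMeasureCrossings H) (f : ℝ → Y) {k E : ℕ} (hk : 1 ≤ k) (hE : 1 ≤ E) {δ : ℝ}
    (hδ : δ = 1 / (8 * k * E))
    (hf : ENNReal.ofReal (1 / E) ≤ distToClass uniform01 f (piecewiseClass k H)) :
    (k - 1) * δ + 1 / (64 * E ^ 2) ≤ volume.real (farSet H f δ (δ / (64 * E))) := by
  by_contra! hcon
  have hk1 : (1 : ℝ) ≤ k := by exact_mod_cast hk
  have hE1 : (1 : ℝ) ≤ E := by exact_mod_cast hE
  have hδ0 : 0 < δ := by rw [hδ]; positivity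
  have hm : δ = 2 / ((16 * k * E : ℕ) : ℝ) := by rw [hδ]; push_cast; field_simp; norm_num
  have hcδ : 2 * (δ / (64 * E)) < δ := by
    rw [← mul_div_assoc, div_lt_iff₀ (by positivity)]
    nlinarith
  obtain ⟨φ, h, hφ, hφK, hh, hdist⟩ := exists_monotone_index_of_farSet hne hZ f
    (m := 16 * k * E) (by nlinarith) hm (c := δ / (64 * E)) (by positivity) hcδ
  set β := volume.real (farSet H f δ (δ / (64 * E))) with hβ
  set r := δ - 2 * (δ / (64 * E)) with hr
  set K := ⌊β / r⌋₊ with hK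
  have hβ0 : 0 ≤ β := measureReal_nonneg
  set y : ℝ := 1 / E with hy
  have hy0 : 0 < y := by positivity
  have hy1 : y ≤ 1 := by rw [hy, div_le_one (by positivity)]; exact hE1
  have hτ : 1 / (64 * (E : ℝ) ^ 2) = k * δ * y / 8 := by rw [hδ, hy]; field_simp; norm_num
  have hr' : r = δ * (1 - y / 32) := by rw [hr, hy]; field_simp; ring
  have hr0 : 0 < r := by linarith
  rw [hτ] at hcon
  -- Dividing by `r = δ * (1 - y / 32)` instead of `δ` is paid for by raising `k * y / 8` to `k * y
  -- / 4`.
  have hKle : (K : ℝ) ≤ k - 1 + k * y / 4 := by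
    refine (Nat.floor_le (div_nonneg hβ0 hr0.le)).trans ?_
    rw [div_le_iff₀ hr0, hr']
    refine hcon.le.trans ?_
    have : (k : ℝ) - 1 + k * y / 8 ≤ (k - 1 + k * y / 4) * (1 - y / 32) := by
      nlinarith [mul_nonneg (by linarith : (0 : ℝ) ≤ k) hy0.le, mul_le_mul_of_nonneg_left hy1
        (mul_nonneg (by linarith : (0 : ℝ) ≤ k) hy0.le)]
    calc ((k : ℝ) - 1) * δ + k * δ * y / 8 = δ * ((k : ℝ) - 1 + k * y / 8) := by ring
      _ ≤ δ * ((k - 1 + k * y / 4) * (1 - y / 32)) := by gcongr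
      _ = _ := by ring
  -- The index takes at most `K + 1` values; truncated subtraction gives no excess when this is at
  -- most `k`.
  have h1 := distToClass_piecewiseClass_le_add hk f (K + 1 - k) hφ
    (fun x => by have := hφK x; omega) hh
  have h2 := (hf.trans h1)
  have h3 : ((K + 1 - k : ℕ) : ENNReal) * (k : ENNReal)⁻¹ ≤ ENNReal.ofReal (y / 4) := by
    rw [← div_eq_mul_inv]
    refine ENNReal.div_le_of_le_mul ?_
    rw [← ENNReal.ofReal_natCast, ← ENNReal.ofReal_natCast,
      ← ENNReal.ofReal_mul (by positivity)]
    refine ENNReal.ofReal_le_ofReal ?_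
    rcases le_total k (K + 1) with hle | hle
    · rw [Nat.cast_sub hle]
      push_cast
      linarith
    · rw [Nat.sub_eq_zero_of_le hle]
      simp only [Nat.cast_zero]
      positivity
  have h4 : ENNReal.ofReal y ≤
      ENNReal.ofReal (uniform01.real {x | f x ≠ h (φ x) x} + y / 4) := by
    rw [ENNReal.ofReal_add measureReal_nonneg (by positivity), ofReal_measureReal]
    exact h2.trans (by gcongr)
  rw [ENNReal.ofReal_le_ofReal_iff (by positivity)] at h4
  have hmc : ((16 * k * E : ℕ) : ℝ) * (δ / (64 * E)) = y / 32 := by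
    rw [hδ, hy]; push_cast; field_simp; norm_num
  have hkδ : k * δ = y / 8 := by rw [hδ, hy]; field_simp
  have h5 : δ * K ≤ δ * (k - 1 + k * y / 4) := by gcongr
  have h6 : δ * (k - 1 + k * y / 4) = y / 8 - δ + y / 8 * y / 4 := by
    rw [← hkδ]; ring
  have h7 : ((k : ℝ) - 1) * δ = y / 8 - δ := by rw [← hkδ]; ring
  rw [hkδ, h7] at hcon
  rw [hmc] at hdist
  have h8 : y * y ≤ y := by nlinarith
  -- The charges are `y/32` for the cells, at most `y/8 + y/32` for the ends and jumps, less than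
  -- `y/8 + y/64` for the far set and `y/4` for the merges: less than `y` in all.
  linarith

/-- The factor `122880 * E ^ 2` is the base of the Sauer–Shelah bound for `20480 * d * E ^ 2`
blocks, and `3072 * E ^ 2` is twice the inverse of the failure probability allowed. -/
theorem le_two_pow_mul_self (E : ℕ) (hE : 1 ≤ E) :
    3072 * 122880 * E ^ 4 ≤ 2 ^ (40 * E) := by
  have h1 : E ^ 4 ≤ 2 ^ (4 * E) := by
    rw [mul_comm, pow_mul]
    exact Nat.pow_le_pow_left Nat.lt_two_pow_self.le 4
  calc 3072 * 122880 * E ^ 4 ≤ 2 ^ 36 * 2 ^ (4 * E) := Nat.mul_le_mul (by norm_num) h1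
    _ ≤ 2 ^ (36 * E) * 2 ^ (4 * E) := by
        gcongr
        · norm_num
        · omega
    _ = 2 ^ (40 * E) := by rw [← pow_add]; congr 1; ring

/-- With `b = 4kE` points, `b * δ = 1/2`, and Bernoulli's inequality gives `(1 - δ)^(b - 1) ≥ 1/2`.
A block thus refutes a given member with probability at least `1/(256E)`, so at least `80dE`
refutations are expected and `e = 40dE` is admissible. The bound on the right is `τ / 24`. -/
theorem measure_pi_exists_consistent_le_of_params {Y : Type u} [MeasurableSpace Y]
    (hY : MeasurableDisagreement Y) {H : Set (ℝ → Y)} (hH : ∀ h ∈ H, Measurable h)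
    (hT : TraceMeasurable uniform01 H) {d : ℕ} (hd0 : 0 < d) (hd : graphDim H = d) {f : ℝ → Y}
    (hf : Measurable f) {k E : ℕ} (hk : 1 ≤ k) (hE : 1 ≤ E) {δ w : ℝ}
    (hδ : δ = 1 / (8 * k * E)) (hw : w ∈ farSet H f δ (δ / (64 * E))) :
    (Measure.pi fun _ => Measure.pi fun _ => uniform01)
      {z : Fin (d * (20480 * E ^ 2)) → Fin (4 * k * E) → ℝ |
        ∃ h ∈ H, ∀ j t, IsHit δ w (z j) t → h (z j t) = f (z j t)} ≤
      ENNReal.ofReal (1 / (1536 * E ^ 2)) := by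
  have hk1 : (1 : ℝ) ≤ k := by exact_mod_cast hk
  have hE1 : (1 : ℝ) ≤ E := by exact_mod_cast hE
  have hd1 : (1 : ℝ) ≤ d := by exact_mod_cast hd0
  have hδ0 : 0 < δ := by rw [hδ]; positivity
  have hδ1 : δ ≤ 1 := by
    rw [hδ, div_le_one (by positivity)]
    nlinarith
  have hbδ : ((4 * k * E : ℕ) : ℝ) * δ = 1 / 2 := by
    rw [hδ]; push_cast; field_simp; norm_num
  have hpow : 1 / 2 ≤ (1 - δ) ^ (4 * k * E - 1) := by
    have h1 := one_add_mul_le_pow (a := -δ) (by linarith) (4 * k * E - 1)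
    rw [← sub_eq_add_neg] at h1
    refine le_trans ?_ h1
    have h2 : ((4 * k * E - 1 : ℕ) : ℝ) ≤ ((4 * k * E : ℕ) : ℝ) := by
      exact_mod_cast Nat.sub_le _ _
    nlinarith
  have hγ : 1 / (256 * E) ≤
      ((4 * k * E : ℕ) : ℝ) * (δ / (64 * E) * (1 - δ) ^ (4 * k * E - 1)) := by
    calc (1 : ℝ) / (256 * E) = ((4 * k * E : ℕ) * δ) * (1 / (64 * E)) * (1 / 2) := by
          rw [hbδ]; field_simp; norm_num
      _ ≤ ((4 * k * E : ℕ) * δ) * (1 / (64 * E)) * (1 - δ) ^ (4 * k * E - 1) := by gcongr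
      _ = _ := by ring
  have hγM : 80 * (d * E : ℝ) ≤
      ((4 * k * E : ℕ) : ℝ) * (δ / (64 * E) * (1 - δ) ^ (4 * k * E - 1)) *
        ((d * (20480 * E ^ 2) : ℕ) : ℝ) := by
    calc 80 * (d * E : ℝ) = 1 / (256 * E) * ((d * (20480 * E ^ 2) : ℕ) : ℝ) := by
          push_cast; field_simp; norm_num
      _ ≤ _ := by gcongr
  have hdE : (1 : ℝ) ≤ d * E := one_le_mul_of_one_le_of_one_le hd1 hE1
  have h1 := measure_pi_exists_consistent_le hY hH hT hd hf (M := d * (20480 * E ^ 2))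
    (b := 4 * k * E) (e := 40 * E * d) hδ0 hw (by push_cast at hγM ⊢; linarith) (by linarith)
  have hw1 : 1 ≤ 20480 * E ^ 2 := by nlinarith
  have h2 := sum_Iic_choose_le (d := d) hw1
  set G : ℕ := ∑ j ∈ Finset.Iic d, (2 * (d * (20480 * E ^ 2))).choose j with hG
  have h3 : (G : ℝ) * 2 * (1536 * E ^ 2) ≤ 2 ^ (40 * E * d) := by
    have h4 : (3072 * E ^ 2 : ℝ) ≤ (3072 * E ^ 2) ^ d := by
      refine le_self_pow₀ ?_ hd0.ne'
      nlinarith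
    calc (G : ℝ) * 2 * (1536 * E ^ 2) = G * (3072 * E ^ 2) := by ring
      _ ≤ (6 * ((20480 * E ^ 2 : ℕ) : ℝ)) ^ d * (3072 * E ^ 2) ^ d := by gcongr
      _ = (3072 * 122880 * E ^ 4 : ℝ) ^ d := by
          rw [← mul_pow]; congr 1; push_cast; ring
      _ ≤ (2 ^ (40 * E)) ^ d := by
          gcongr
          exact_mod_cast le_two_pow_mul_self E hE
      _ = _ := by rw [← pow_mul]
  rw [← ENNReal.le_div_iff_mul_le (by simp) (by simp)] at h1
  refine h1.trans ?_
  refine ENNReal.div_le_of_le_mul ?_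
  have h5 : (2 : ENNReal) ^ (40 * E * d) = ENNReal.ofReal (2 ^ (40 * E * d)) := by
    rw [ENNReal.ofReal_pow (by norm_num)]; simp
  have h6 : 2 * (G : ENNReal) = ENNReal.ofReal (2 * G) := by
    rw [ENNReal.ofReal_mul (by norm_num)]; simp
  rw [h5, h6, ← ENNReal.ofReal_mul (by positivity)]
  refine ENNReal.ofReal_le_ofReal ?_
  rw [div_mul_eq_mul_div, one_mul, le_div_iff₀ (by positivity)]
  linarith

/-! ### The tester and its error probabilities. -/

/-- Some member of `H` agrees with `f` at all hits of the window at `w`, where the sample `x` is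
divided into `M` blocks of `b` points. -/
def WindowConsistent {Y : Type u} (H : Set (ℝ → Y)) (f : ℝ → Y) {M b : ℕ} (δ : ℝ)
    (x : Fin (M * b) → ℝ) (w : ℝ) : Prop :=
  ∃ h ∈ H, ∀ (j : Fin M) (t : Fin b), IsHit δ w (fun t => x (finProdFinEquiv (j, t))) t →
    h (x (finProdFinEquiv (j, t))) = f (x (finProdFinEquiv (j, t)))

open Classical in
/-- The strategy which queries the hits of `N` windows and accepts if at most `θ` of the windows are
inconsistent with `H`. -/
theorem exists_strategy {Y : Type u} (H : Set (ℝ → Y)) (N M : ℕ) {b : ℕ} (hb : 0 < b) (δ θ : ℝ) :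
    ∃ A : (Fin (M * b) → ℝ) → (Fin N → ℝ) → QueryTree (M * b) Y (N * M),
      ∀ (f : ℝ → Y) (x : Fin (M * b) → ℝ) (ω : Fin N → ℝ),
        (A x ω).run (fun i => f (x i)) = true ↔
        ((Finset.univ.filter fun i => ¬ WindowConsistent H f δ x (ω i)).card : ℝ) ≤ θ := by
  have : Nonempty (Fin b) := ⟨⟨0, hb⟩⟩
  -- The hit of the block if there is one; otherwise an arbitrary point, whose value the decision
  -- ignores.
  set sel : (Fin (M * b) → ℝ) → ℝ → Fin M → Fin b := fun x w j =>
    Classical.epsilon fun t => IsHit δ w (fun t => x (finProdFinEquiv (j, t))) t with hsel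
  set idx : (Fin (M * b) → ℝ) → (Fin N → ℝ) → Fin (N * M) → Fin (M * b) := fun x ω q =>
    finProdFinEquiv ((finProdFinEquiv.symm q).2,
      sel x (ω (finProdFinEquiv.symm q).1) (finProdFinEquiv.symm q).2) with hidx
  refine ⟨fun x ω => QueryTree.nonadaptive (N * M) (idx x ω) fun v => decide
    (((Finset.univ.filter fun i => ¬ ∃ h ∈ H, ∀ (j : Fin M) (t : Fin b),
      IsHit δ (ω i) (fun t => x (finProdFinEquiv (j, t))) t →
      h (x (finProdFinEquiv (j, t))) = v (finProdFinEquiv (i, j))).card : ℝ) ≤ θ), ?_⟩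
  intro f x ω
  rw [QueryTree.run_nonadaptive, decide_eq_true_iff]
  have hcongr : ∀ i : Fin N, (∃ h ∈ H, ∀ (j : Fin M) (t : Fin b),
      IsHit δ (ω i) (fun t => x (finProdFinEquiv (j, t))) t →
      h (x (finProdFinEquiv (j, t))) = f (x (idx x ω (finProdFinEquiv (i, j))))) ↔
      WindowConsistent H f δ x (ω i) := by
    intro i
    refine exists_congr fun h => and_congr_right fun _ => forall_congr' fun j =>
      forall_congr' fun t => forall_congr' fun ht => ?_
    have hs : sel x (ω i) j = t :=
      (Classical.epsilon_spec (p := fun t =>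
        IsHit δ (ω i) (fun t => x (finProdFinEquiv (j, t))) t) ⟨t, ht⟩).unique ht
    simp only [hidx, Equiv.symm_apply_apply, hs]
  simp only [hcongr]

theorem nullMeasurableSet_windowConsistent {Y : Type u} [MeasurableSpace Y] {H : Set (ℝ → Y)}
    (hT : TraceMeasurable uniform01 H) {f : ℝ → Y} (hf : Measurable f) {N M b : ℕ} (δ : ℝ)
    (i : Fin N) :
    NullMeasurableSet {z : (Fin (M * b) → ℝ) × (Fin N → ℝ) | WindowConsistent H f δ z.1 (z.2 i)}
      ((Measure.pi fun _ => uniform01).prod (Measure.pi fun _ => uniform01)) := by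
  refine nullMeasurableSet_exists_trace (Q := (Measure.pi fun _ : Fin (M * b) => uniform01).prod
    (Measure.pi fun _ : Fin N => uniform01)) hT hf Measure.quasiMeasurePreserving_fst
    (fun J z => ∀ (j : Fin M) (t : Fin b), IsHit δ (z.2 i)
      (fun t => z.1 (finProdFinEquiv (j, t))) t → finProdFinEquiv (j, t) ∈ J) fun J => ?_
  refine MeasurableSet.nullMeasurableSet ?_
  rw [Set.ofPred_forall]
  refine MeasurableSet.iInter fun j => ?_
  rw [Set.ofPred_forall]
  refine MeasurableSet.iInter fun t => ?_
  have h := measurableSet_isHit (X := (Fin (M * b) → ℝ) × (Fin N → ℝ)) δ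
    (w := fun z => z.2 i) (z := fun z t => z.1 (finProdFinEquiv (j, t))) (by fun_prop)
    (by fun_prop) t
  simp only [imp_iff_not_or]
  exact h.compl.union (MeasurableSet.const _)

/-- Passing to a measurable subset of full measure, not a superset, lets its sections inherit the
bound. -/
theorem prod_le_of_forall_section_le {X W : Type*} [MeasurableSpace X] [MeasurableSpace W]
    (P : Measure X) [IsProbabilityMeasure P] (Q : Measure W) [IsProbabilityMeasure Q]
    {S : Set (X × W)} (hS : NullMeasurableSet S (P.prod Q)) {ζ : ENNReal}
    (h : ∀ w, P {x | (x, w) ∈ S} ≤ ζ) : (P.prod Q) S ≤ ζ := by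
  obtain ⟨T, hTS, hT, hTae⟩ := hS.exists_measurable_subset_ae_eq
  rw [← measure_congr hTae, Measure.prod_apply_symm hT]
  calc ∫⁻ w, P ((fun x => (x, w)) ⁻¹' T) ∂Q ≤ ∫⁻ _, ζ ∂Q :=
        lintegral_mono fun w => (measure_mono (Set.preimage_mono hTS)).trans (h w)
    _ = ζ := by simp

open Classical in
/-- Markov's inequality for the number of events which occur. -/
theorem mul_measure_le_card_filter {X ι : Type*} [MeasurableSpace X] [Fintype ι] (Q : Measure X)
    {S : ι → Set X} (hS : ∀ i, NullMeasurableSet (S i) Q) {ζ : ENNReal} (h : ∀ i, Q (S i) ≤ ζ)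
    (a : ℝ) :
    ENNReal.ofReal a * Q {x | a ≤ ((Finset.univ.filter fun i => x ∈ S i).card : ℝ)} ≤
      Fintype.card ι * ζ := by
  have hm : ∀ i, AEMeasurable ((S i).indicator (1 : X → ENNReal)) Q := fun i =>
    (aemeasurable_indicator_const_iff 1).2 (hS i)
  have hcard : ∀ x, (∑ i, (S i).indicator (1 : X → ENNReal) x) =
      ((Finset.univ.filter fun i => x ∈ S i).card : ENNReal) := by
    intro x
    simp [Set.indicator_apply]
  calc _ ≤ ENNReal.ofReal a * Q {x | ENNReal.ofReal a ≤
        ∑ i, (S i).indicator (1 : X → ENNReal) x} := by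
        gcongr with x
        intro hx
        rw [hcard, ← ENNReal.ofReal_natCast]
        exact ENNReal.ofReal_le_ofReal hx
    _ ≤ ∫⁻ x, ∑ i, (S i).indicator (1 : X → ENNReal) x ∂Q :=
        mul_meas_ge_le_lintegral₀ (Finset.aemeasurable_fun_sum _ fun i _ => hm i) _
    _ = ∑ i, Q (S i) := by
        rw [lintegral_finsetSum' _ fun i _ => hm i]
        exact Finset.sum_congr rfl fun i _ => lintegral_indicator_one₀ (hS i)
    _ ≤ ∑ _i : ι, ζ := Finset.sum_le_sum fun i _ => h i
    _ = _ := by simp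

theorem two_thirds_le_of_compl_le {X : Type*} [MeasurableSpace X] (Q : Measure X)
    [IsProbabilityMeasure Q] {S : Set X} (h : Q Sᶜ ≤ 1 / 3) : 2 / 3 ≤ Q S := by
  have h1 : (1 : ENNReal) ≤ Q S + 1 / 3 := by
    rw [← measure_univ (μ := Q), ← Set.union_compl_self S]
    exact (measure_union_le _ _).trans (by gcongr; rwa [Set.union_compl_self, measure_univ])
  have h2 : (1 : ENNReal) = 2 / 3 + 1 / 3 := by
    rw [← ENNReal.add_div, show (2 : ENNReal) + 1 = 3 by norm_num, ENNReal.div_self] <;> simp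
  exact (ENNReal.add_le_add_iff_right (by simp)).1 (h2.symm.le.trans h1)

open Classical in
-- Inconsistent windows start in a set of measure at most `(k - 1) * δ`. Rejection requires their
-- number to exceed its mean by `N * τ / 2`, which has probability at most `4 / (N * τ ^ 2) = 1/24`.
theorem measure_prod_compl_accept_le {Y : Type u} {H : Set (ℝ → Y)} {f : ℝ → Y}
    {k : ℕ} (hk : 1 ≤ k) (hf : f ∈ piecewiseClass k H) {N M b : ℕ} {δ τ : ℝ} (hδ : 0 ≤ δ)
    (hτ : 0 < τ) (hN : N * τ ^ 2 = 96) :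
    ((Measure.pi fun _ => uniform01).prod (Measure.pi fun _ => uniform01))
      {z : (Fin (M * b) → ℝ) × (Fin N → ℝ) | ((Finset.univ.filter fun i =>
        ¬ WindowConsistent H f δ z.1 (z.2 i)).card : ℝ) ≤ ((k - 1) * δ + τ / 2) * N}ᶜ ≤ 1 / 3 := by
  obtain ⟨A, hA, hAle, hAgood⟩ := exists_breakpoints_of_mem_piecewiseClass hk hf δ
  have hN0 : (0 : ℝ) < N := by
    by_contra hcon
    nlinarith [sq_nonneg τ]
  have hk1 : (1 : ℝ) ≤ k := by exact_mod_cast hk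
  have hp1 : uniform01.real A ≤ 1 := measureReal_le_one
  have hp : uniform01.real A ≤ (k - 1) * δ :=
    ENNReal.toReal_le_of_le_ofReal (mul_nonneg (by linarith) hδ) hAle
  have hp' : (N : ℝ) * uniform01.real A ≤ N * ((k - 1) * δ) := by gcongr
  have hcheb := measure_pi_le_abs_card_sub (ι := Fin N) uniform01 hA
    (a := N * τ / 2) (by positivity)
  rw [Fintype.card_fin] at hcheb
  have hsub : {z : (Fin (M * b) → ℝ) × (Fin N → ℝ) | ((Finset.univ.filter fun i =>
      ¬ WindowConsistent H f δ z.1 (z.2 i)).card : ℝ) ≤ ((k - 1) * δ + τ / 2) * N}ᶜ ⊆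
      Set.univ ×ˢ {ω : Fin N → ℝ | N * τ / 2 ≤
        |((Finset.univ.filter fun i => ω i ∈ A).card : ℝ) - N * uniform01.real A|} := by
    rintro ⟨x, ω⟩ hz
    refine ⟨Set.mem_univ _, ?_⟩
    simp only [Set.mem_compl_iff, Set.mem_ofPred_eq, not_le] at hz ⊢
    have h1 : (Finset.univ.filter fun i => ¬ WindowConsistent H f δ x (ω i)).card ≤
        (Finset.univ.filter fun i => ω i ∈ A).card := by
      refine Finset.card_le_card fun i hi => Finset.mem_filter.2 ⟨Finset.mem_univ _, ?_⟩
      by_contra hiA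
      obtain ⟨h, hh, hagree⟩ := hAgood _ hiA
      exact (Finset.mem_filter.1 hi).2 ⟨h, hh, fun j t ht => hagree _ ht.1⟩
    have h2 : ((Finset.univ.filter fun i => ¬ WindowConsistent H f δ x (ω i)).card : ℝ) ≤
        (Finset.univ.filter fun i => ω i ∈ A).card := by exact_mod_cast h1
    refine le_trans ?_ (le_abs_self _)
    linarith
  refine (measure_mono hsub).trans ?_
  rw [Measure.prod_prod, measure_univ, one_mul]
  refine hcheb.trans ?_
  rw [show (1 / 3 : ENNReal) = ENNReal.ofReal (1 / 3) by
    rw [ENNReal.ofReal_div_of_pos (by norm_num)]; simp]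
  refine ENNReal.ofReal_le_ofReal ?_
  rw [div_le_iff₀ (by positivity)]
  have h3 : (N : ℝ) * uniform01.real A ≤ N * 1 := by gcongr
  have h4 : 1 / 3 * ((N : ℝ) * τ / 2) ^ 2 = N * (N * τ ^ 2) / 12 := by ring
  rw [h4, hN]
  linarith

theorem measure_pi_windowConsistent_le {Y : Type u} [MeasurableSpace Y]
    (hY : MeasurableDisagreement Y) {H : Set (ℝ → Y)} (hH : ∀ h ∈ H, Measurable h)
    (hT : TraceMeasurable uniform01 H) {d : ℕ} (hd0 : 0 < d) (hd : graphDim H = d) {f : ℝ → Y}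
    (hf : Measurable f) {k E : ℕ} (hk : 1 ≤ k) (hE : 1 ≤ E) {δ w : ℝ}
    (hδ : δ = 1 / (8 * k * E)) (hw : w ∈ farSet H f δ (δ / (64 * E))) :
    (Measure.pi fun _ => uniform01)
      {x : Fin (d * (20480 * E ^ 2) * (4 * k * E)) → ℝ | WindowConsistent H f δ x w} ≤
      ENNReal.ofReal (1 / (1536 * E ^ 2)) := by
  have h1 := measurePreserving_blocks
    (finProdFinEquiv (m := d * (20480 * E ^ 2)) (n := 4 * k * E)) uniform01
  refine le_trans ?_ (measure_pi_exists_consistent_le_of_params hY hH hT hd0 hd hf hk hE hδ hw)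
  rw [← h1.map_eq]
  exact Measure.le_map_apply h1.measurable.aemeasurable _

open Classical in
-- Outside two events of probability at most `1/6`, more than `N((k - 1)δ + τ) - Nτ/4` windows are
-- far (Chebyshev) and fewer than `Nτ/4` windows are far yet consistent (Markov). The difference
-- exceeds the threshold.
theorem measure_prod_accept_le {Y : Type u} [MeasurableSpace Y]
    (hY : MeasurableDisagreement Y) {H : Set (ℝ → Y)} (hne : H.Nonempty)
    (hH : ∀ h ∈ H, Measurable h) (hZ : ZeroMeasureCrossings H)
    (hT : TraceMeasurable uniform01 H) {d : ℕ} (hd0 : 0 < d) (hd : graphDim H = d) {f : ℝ → Y}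
    (hf : Measurable f) {k E : ℕ} (hk : 1 ≤ k) (hE : 1 ≤ E) {δ τ : ℝ}
    (hδ : δ = 1 / (8 * k * E)) (hτ : τ = 1 / (64 * E ^ 2)) {N : ℕ} (hN : N * τ ^ 2 = 96)
    (hfar : ENNReal.ofReal (1 / E) ≤ distToClass uniform01 f (piecewiseClass k H)) :
    ((Measure.pi fun _ => uniform01).prod (Measure.pi fun _ => uniform01))
      {z : (Fin (d * (20480 * E ^ 2) * (4 * k * E)) → ℝ) × (Fin N → ℝ) |
        ((Finset.univ.filter fun i => ¬ WindowConsistent H f δ z.1 (z.2 i)).card : ℝ) ≤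
          ((k - 1) * δ + τ / 2) * N} ≤ 1 / 3 := by
  have hE1 : (1 : ℝ) ≤ E := by exact_mod_cast hE
  have hτ0 : 0 < τ := by rw [hτ]; positivity
  have hN0 : (0 : ℝ) < N := by
    by_contra hcon
    nlinarith [sq_nonneg τ]
  have hδ0 : 0 < δ := by
    have : (1 : ℝ) ≤ k := by exact_mod_cast hk
    rw [hδ]; positivity
  set B := farSet H f δ (δ / (64 * E)) with hB
  have hBm : MeasurableSet B := measurableSet_farSet H f δ _
  have hB01 : B ⊆ Set.Ioo 0 1 := fun w hw => ⟨hw.1.1, hw.1.2.trans (by linarith)⟩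
  have hp : (k - 1) * δ + τ ≤ uniform01.real B := by
    rw [uniform01, measureReal_restrict_apply hBm, Set.inter_eq_left.2 hB01, hτ]
    exact le_volume_farSet_of_le_distToClass hne hZ f hk hE hδ hfar
  have hp' : (N : ℝ) * ((k - 1) * δ + τ) ≤ N * uniform01.real B := by gcongr
  have hp1 : (N : ℝ) * uniform01.real B ≤ N * 1 := by
    gcongr
    exact measureReal_le_one
  have hcheb := measure_pi_le_abs_card_sub (ι := Fin N) uniform01 hBm
    (a := N * τ / 4) (by positivity)
  rw [Fintype.card_fin] at hcheb
  set Q : Measure ((Fin (d * (20480 * E ^ 2) * (4 * k * E)) → ℝ) × (Fin N → ℝ)) :=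
    (Measure.pi fun _ => uniform01).prod (Measure.pi fun _ => uniform01) with hQ
  set U : Fin N → Set ((Fin (d * (20480 * E ^ 2) * (4 * k * E)) → ℝ) × (Fin N → ℝ)) := fun i =>
    {z | z.2 i ∈ B} ∩ {z | WindowConsistent H f δ z.1 (z.2 i)} with hU
  have hUm : ∀ i, NullMeasurableSet (U i) Q := fun i =>
    ((measurable_pi_apply i).comp measurable_snd hBm).nullMeasurableSet.inter
      (nullMeasurableSet_windowConsistent hT hf δ i)
  -- The positions are fixed first: for each far one the sample fails to refute `H` with probability
  -- at most `τ / 24`.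
  have hUle : ∀ i, Q (U i) ≤ ENNReal.ofReal (τ / 24) := by
    intro i
    refine prod_le_of_forall_section_le _ _ (hUm i) fun ω => ?_
    have hτ' : τ / 24 = 1 / (1536 * E ^ 2) := by rw [hτ]; field_simp; norm_num
    by_cases hω : ω i ∈ B
    · rw [hτ']
      exact (measure_mono fun x hx => hx.2).trans
        (measure_pi_windowConsistent_le hY hH hT hd0 hd hf hk hE hδ hω)
    · rw [show {x | (x, ω) ∈ U i} = ∅ from Set.eq_empty_of_forall_notMem fun x hx => hω hx.1]
      simp
  have hmarkov := mul_measure_le_card_filter Q hUm hUle (N * τ / 4)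
  set S₂ := {z | N * τ / 4 ≤ ((Finset.univ.filter fun i => z ∈ U i).card : ℝ)} with hS₂
  have h6 : (1 / 6 : ENNReal) = ENNReal.ofReal (1 / 6) := by
    rw [ENNReal.ofReal_div_of_pos (by norm_num)]; simp
  have hS₂le : Q S₂ ≤ 1 / 6 := by
    have h1 : ((Fintype.card (Fin N) : ℕ) : ENNReal) * ENNReal.ofReal (τ / 24) =
        ENNReal.ofReal (N * τ / 4) * (1 / 6) := by
      rw [h6, Fintype.card_fin, ← ENNReal.ofReal_natCast, ← ENNReal.ofReal_mul hN0.le,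
        ← ENNReal.ofReal_mul (by positivity)]
      congr 1
      ring
    rw [h1] at hmarkov
    have h2 : ENNReal.ofReal (N * τ / 4) * Q S₂ ≤ ENNReal.ofReal (N * τ / 4) * (1 / 6) := by
      convert! hmarkov
    refine (ENNReal.mul_le_mul_iff_right ?_ ENNReal.ofReal_ne_top).1 h2
    exact (ENNReal.ofReal_pos.2 (by positivity)).ne'
  have hsub : {z : (Fin (d * (20480 * E ^ 2) * (4 * k * E)) → ℝ) × (Fin N → ℝ) |
        ((Finset.univ.filter fun i => ¬ WindowConsistent H f δ z.1 (z.2 i)).card : ℝ) ≤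
          ((k - 1) * δ + τ / 2) * N} ⊆
      Set.univ ×ˢ {ω : Fin N → ℝ | N * τ / 4 ≤
        |((Finset.univ.filter fun i => ω i ∈ B).card : ℝ) - N * uniform01.real B|} ∪ S₂ := by
    rintro ⟨x, ω⟩ hz
    by_contra hcon
    simp only [Set.mem_union, Set.mem_prod, Set.mem_univ, true_and, Set.mem_ofPred_eq, not_or,
      not_le, hS₂] at hcon hz
    obtain ⟨h1, h2⟩ := hcon
    have h3 := (abs_lt.1 h1).1
    have h4 : (Finset.univ.filter fun i => ω i ∈ B).card ≤
        (Finset.univ.filter fun i => ¬ WindowConsistent H f δ x (ω i)).card +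
        (Finset.univ.filter fun i => (x, ω) ∈ U i).card := by
      refine le_trans (Finset.card_le_card fun i hi => ?_) (Finset.card_union_le _ _)
      have hiB := (Finset.mem_filter.1 hi).2
      by_cases hc : WindowConsistent H f δ x (ω i)
      · exact Finset.mem_union_right _ (Finset.mem_filter.2 ⟨Finset.mem_univ _, hiB, hc⟩)
      · exact Finset.mem_union_left _ (Finset.mem_filter.2 ⟨Finset.mem_univ _, hc⟩)
    have h5 : ((Finset.univ.filter fun i => ω i ∈ B).card : ℝ) ≤
        (Finset.univ.filter fun i => ¬ WindowConsistent H f δ x (ω i)).card +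
        (Finset.univ.filter fun i => (x, ω) ∈ U i).card := by exact_mod_cast h4
    linarith
  refine (measure_mono hsub).trans ((measure_union_le _ _).trans ?_)
  rw [hQ, Measure.prod_prod, measure_univ, one_mul]
  have hcheb' : ENNReal.ofReal (N * uniform01.real B / (N * τ / 4) ^ 2) ≤ 1 / 6 := by
    rw [h6]
    refine ENNReal.ofReal_le_ofReal ?_
    rw [div_le_iff₀ (by positivity)]
    have h7 : 1 / 6 * ((N : ℝ) * τ / 4) ^ 2 = N * (N * τ ^ 2) / 96 := by ring
    rw [h7, hN]
    linarith
  calc _ ≤ (1 / 6 + 1 / 6 : ENNReal) := add_le_add (hcheb.trans hcheb') hS₂le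
    _ = 1 / 3 := by
      rw [h6, ← ENNReal.ofReal_add (by norm_num) (by norm_num),
        show (1 / 6 + 1 / 6 : ℝ) = 1 / 3 by norm_num, ENNReal.ofReal_div_of_pos (by norm_num)]
      simp

theorem hasActiveTester_piecewiseClass {Y : Type u} [MeasurableSpace Y]
    (hY : MeasurableDisagreement Y) {H : Set (ℝ → Y)} (hne : H.Nonempty)
    (hH : ∀ h ∈ H, Measurable h) (hZ : ZeroMeasureCrossings H)
    (hT : TraceMeasurable uniform01 H) {d : ℕ} (hd0 : 0 < d) (hd : graphDim H = d)
    {k E : ℕ} (hk : 1 ≤ k) (hE : 1 ≤ E) {ε : ℝ} (hε : 1 / E ≤ ε) :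
    HasActiveTester uniform01 (piecewiseClass k H) ε (d * (20480 * E ^ 2) * (4 * k * E))
      (393216 * E ^ 4 * (d * (20480 * E ^ 2))) := by
  classical
  have hE1 : (1 : ℝ) ≤ E := by exact_mod_cast hE
  set δ : ℝ := 1 / (8 * k * E) with hδ
  set τ : ℝ := 1 / (64 * E ^ 2) with hτ
  have hτ0 : 0 < τ := by rw [hτ]; positivity
  have hδ0 : 0 ≤ δ := by rw [hδ]; positivity
  have hN : ((393216 * E ^ 4 : ℕ) : ℝ) * τ ^ 2 = 96 := by
    rw [hτ]; push_cast; field_simp; norm_num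
  obtain ⟨A, hA⟩ := exists_strategy H (393216 * E ^ 4) (d * (20480 * E ^ 2)) (b := 4 * k * E)
    (by positivity) δ (((k - 1) * δ + τ / 2) * ((393216 * E ^ 4 : ℕ) : ℝ))
  refine ⟨Fin (393216 * E ^ 4) → ℝ, inferInstance, Measure.pi fun _ => uniform01, inferInstance,
    A, fun f hf => ?_⟩
  have hset : {z : (Fin (d * (20480 * E ^ 2) * (4 * k * E)) → ℝ) × (Fin (393216 * E ^ 4) → ℝ) |
      (A z.1 z.2).run (fun i => f (z.1 i)) = true} =
      {z | ((Finset.univ.filter fun i => ¬ WindowConsistent H f δ z.1 (z.2 i)).card : ℝ) ≤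
        ((k - 1) * δ + τ / 2) * ((393216 * E ^ 4 : ℕ) : ℝ)} := by
    ext z
    simp only [Set.mem_ofPred_eq]
    convert! hA f z.1 z.2
  refine ⟨?_, fun hfF => ?_, fun hfar => ?_⟩
  · rw [hset]
    have h1 := nullMeasurableSet_le_card_filter
      (p := fun i (z : (Fin (d * (20480 * E ^ 2) * (4 * k * E)) → ℝ) ×
        (Fin (393216 * E ^ 4) → ℝ)) => ¬ WindowConsistent H f δ z.1 (z.2 i))
      (fun i => (nullMeasurableSet_windowConsistent hT hf δ i).compl)
      (⌊((k - 1) * δ + τ / 2) * ((393216 * E ^ 4 : ℕ) : ℝ)⌋₊ + 1)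
    convert! h1.compl using 1
    ext z
    have hk1 : (1 : ℝ) ≤ k := by exact_mod_cast hk
    have hpos : 0 ≤ ((k - 1) * δ + τ / 2) * ((393216 * E ^ 4 : ℕ) : ℝ) :=
      mul_nonneg (add_nonneg (mul_nonneg (by linarith) hδ0) (by positivity)) (by positivity)
    simp only [Set.mem_ofPred_eq, Set.mem_compl_iff, not_le, Nat.lt_add_one_iff,
      Nat.le_floor_iff hpos]
    convert! Iff.rfl
  · refine two_thirds_le_of_compl_le _ ?_
    rw [hset]
    convert! measure_prod_compl_accept_le hk hfF hδ0 hτ0 hN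
  · refine two_thirds_le_of_compl_le _ ?_
    have hcompl : {z : (Fin (d * (20480 * E ^ 2) * (4 * k * E)) → ℝ) ×
        (Fin (393216 * E ^ 4) → ℝ) | (A z.1 z.2).run (fun i => f (z.1 i)) = false}ᶜ =
        {z | (A z.1 z.2).run (fun i => f (z.1 i)) = true} := by
      ext z
      simp
    rw [hcompl, hset]
    convert! measure_prod_accept_le hY hne hH hZ hT hd0 hd hf hk hE hδ hτ hN
      ((ENNReal.ofReal_le_ofReal hε).trans hfar)

theorem theorem1 :
    ∃ C : ℝ, 0 < C ∧
      ∀ (Y : Type u) [MeasurableSpace Y], MeasurableDisagreement Y →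
      ∀ H : Set (ℝ → Y), H.Nonempty → (∀ h ∈ H, Measurable h) →
        ZeroMeasureCrossings H → TraceMeasurable uniform01 H →
      ∀ d : ℕ, 0 < d → graphDim H = d →
      ∀ k : ℕ, 1 ≤ k →
      ∀ ε : ℝ, 0 < ε → ε < 1 / 2 →
        ∃ s q : ℕ,
          (s : ℝ) ≤ C * (d * k / ε ^ 6 * Real.log (1 / ε)) ∧
          (q : ℝ) ≤ C * (d / ε ^ 8 * Real.log (1 / ε)) ∧
          HasActiveTester uniform01 (piecewiseClass k H) ε s q := by
  refine ⟨10 ^ 12, by norm_num, ?_⟩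
  intro Y _ hY H hne hH hZ hT d hd0 hd k hk ε hε0 hε
  set a : ℝ := 1 / ε with ha
  have ha2 : 2 < a := by
    rw [ha, lt_div_iff₀ hε0]
    linarith
  have hE : 1 ≤ ⌈a⌉₊ := Nat.one_le_iff_ne_zero.2 (Nat.ceil_pos.2 (by linarith)).ne'
  have hEa : (⌈a⌉₊ : ℝ) ≤ 2 * a := by
    have := Nat.ceil_lt_add_one (show 0 ≤ a by linarith)
    linarith
  have hlog : 1 / 2 ≤ Real.log a := by
    have h1 := Real.log_le_log (by norm_num) ha2.le
    have h2 := Real.log_two_gt_d9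
    linarith
  have hεa : 1 / (⌈a⌉₊ : ℝ) ≤ ε := by
    rw [div_le_iff₀ (by positivity)]
    have h1 : a ≤ ⌈a⌉₊ := Nat.le_ceil a
    have h2 : ε * a = 1 := by rw [ha]; field_simp
    nlinarith
  -- The tester uses `O(dk/ε³)` points and `O(d/ε⁶)` queries; the remaining powers of `1/ε` and the
  -- logarithm, which is at least `1/2`, are slack.
  refine ⟨_, _, ?_, ?_, hasActiveTester_piecewiseClass hY hne hH hZ hT hd0 hd hk hE hεa⟩
  · have h1 : (d : ℝ) * k / ε ^ 6 * Real.log a = d * k * a ^ 6 * Real.log a := by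
      rw [ha]; simp [div_eq_mul_inv]
    rw [h1]
    push_cast
    have h2 : a ^ 3 * 1 ≤ a ^ 3 * a ^ 3 := by
      gcongr
      exact one_le_pow₀ (by linarith)
    calc (d : ℝ) * (20480 * (⌈a⌉₊ : ℝ) ^ 2) * (4 * k * ⌈a⌉₊)
        = d * k * (81920 * (⌈a⌉₊ : ℝ) ^ 3) := by ring
      _ ≤ d * k * (81920 * (2 * a) ^ 3) := by gcongr
      _ = 655360 * (d * k * (a ^ 3 * 1)) := by ring
      _ ≤ 655360 * (d * k * (a ^ 3 * a ^ 3)) := by gcongr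
      _ ≤ (10 ^ 12 * (1 / 2)) * (d * k * (a ^ 3 * a ^ 3)) := by
          gcongr
          norm_num
      _ = 10 ^ 12 * (d * k * a ^ 6 * (1 / 2)) := by ring
      _ ≤ 10 ^ 12 * (d * k * a ^ 6 * Real.log a) := by gcongr
  · have h1 : (d : ℝ) / ε ^ 8 * Real.log a = d * a ^ 8 * Real.log a := by
      rw [ha]; simp [div_eq_mul_inv]
    rw [h1]
    push_cast
    have h2 : a ^ 6 * 2 ^ 2 ≤ a ^ 6 * a ^ 2 := by gcongr
    calc 393216 * (⌈a⌉₊ : ℝ) ^ 4 * (d * (20480 * (⌈a⌉₊ : ℝ) ^ 2))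
        = d * (393216 * 20480 * (⌈a⌉₊ : ℝ) ^ 6) := by ring
      _ ≤ d * (393216 * 20480 * (2 * a) ^ 6) := by gcongr
      _ = (393216 * 20480 * 16) * (d * (a ^ 6 * 2 ^ 2)) := by ring
      _ ≤ (393216 * 20480 * 16) * (d * (a ^ 6 * a ^ 2)) := by gcongr
      _ ≤ (10 ^ 12 * (1 / 2)) * (d * (a ^ 6 * a ^ 2)) :=
          mul_le_mul_of_nonneg_right (by norm_num) (by positivity)
      _ = 10 ^ 12 * (d * a ^ 8 * (1 / 2)) := by ring
      _ ≤ 10 ^ 12 * (d * a ^ 8 * Real.log a) := by gcongr
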